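/- **Theorem.** Let $m,p\ge 1$. For $a=(a_n)_{n=1}^{p-1}$ and $b=(b_n)_{n=1}^{p}$, sequences of complex $m\times m$ matrices with $b_n=b_n^*$ and $\det a_n\ne 0$, let $\mathcal J_{a,b}$ be the self-adjoint $mp\times mp$ block tridiagonal (Jacobi) matrix with diagonal blocks $b_1,\dots,b_p$, superdiagonal blocks $a_1,\dots,a_{p-1}$ and subdiagonal blocks $a_1^*,\dots,a_{p-1}^*$. Put $a_0=a_p=I$ and define $m\times m$ matrix polynomials $\varphi_0,\dots,\varphi_{p+1}$ by $\varphi_0=0$, $\varphi_1=I$ and $$a_n\varphi_{n+1}(z)+b_n\varphi_n(z)+a_{n-1}^*\varphi_{n-1}(z)=z\,\varphi_n(z),\qquad 1\le n\le p .$$ Let $\lambda_1<\dots<\lambda_N$ be the distinct eigenvalues of $\mathcal J_{a,b}$. For each $j$ let $P_j$ be the orthogonal projector of $\mathbb C^m$ onto $\operatorname{Ker}\varphi_{p+1}(\lambda_j)$, and let $g_j:\operatorname{Ran}P_j\to\operatorname{Ran}P_j$ be the restriction of $P_j\sum_{n=1}^p\varphi_n(\lambda_j)^*\varphi_n(\lambda_j)P_j$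 to $\operatorname{Ran}P_j$. Set $\Psi(a,b)=(\lambda_j,P_j,g_j)_{j=1}^N$. Let $\mathcal S_p$ be the set of all tuples $(\lambda_j,P_j,g_j)_{j=1}^N$ (where $N$ is not fixed) such that * $p\le N\le pm$, and $\lambda_1<\dots<\lambda_N$ are real numbers; * $\{(\lambda_j,P_j)\}$ is a $p$-tame system with all $P_j\neq 0$; that is, the $P_j$ are nonzero orthogonal projectors in $\mathbb C^m$, $\sum_{j=1}^N\operatorname{rank}P_j=mp$, and the $mp\times mp$ block Hankel matrix $(T_{s+k})_{s,k=0}^{p-1}$ with $T_s=\sum_{j=1}^N\lambda_j^sP_j$ has nonzero determinant; * $g_j:\operatorname{Ran}P_j\to\operatorname{Ran}P_j$ are linear operators with $g_j=g_j^*>0$, and $\sum_{j=1}^N P_jg_j^{-1}P_j=I$. Let $\mathbf S$ be the set of self-adjoint, $\mathbf S_+$ the set of positive definite, and $\mathbf L_+$ the set of lower triangular complex $m\times m$ matrices, those in $\mathbf L_+$ having real positive diagonal entries. Then: (i) $\Psi$ maps $\mathbf S_+^{p-1}\times\mathbf S^p$ bijectively onto $\mathcal S_p$; (ii) $\Psi$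 maps $\mathbf L_+^{p-1}\times\mathbf S^p$ bijectively onto $\mathcal S_p$. -/

import Mathlib

noncomputable section

namespace MatrixJacobi

open scoped Matrix ComplexOrder

/-- The sequence `a_0, a_1, …, a_p`: `a_1, …, a_{p-1}` are the given
off-diagonal blocks (the entry `a ⟨i, _⟩` of the tuple is `a_{i+1}`), and `a_0 = a_p = I`. -/
def offDiag {m p : ℕ} (a : Fin (p - 1) → Matrix (Fin m) (Fin m) ℂ) (n : ℕ) :
    Matrix (Fin m) (Fin m) ℂ :=
  if h : 1 ≤ n ∧ n < p then a ⟨n - 1, by omega⟩ else 1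

/-- The diagonal blocks `b_1, …, b_p`, numbered from `1` (the entry `b ⟨i, _⟩` of the tuple is
`b_{i+1}`); the value `0` outside `1 ≤ n ≤ p` is never used. -/
def diag {m p : ℕ} (b : Fin p → Matrix (Fin m) (Fin m) ℂ) (n : ℕ) :
    Matrix (Fin m) (Fin m) ℂ :=
  if h : 1 ≤ n ∧ n ≤ p then b ⟨n - 1, by omega⟩ else 0

/-- The `p × p` array of `m × m` blocks of the Jacobi operator: `b_n` at `(n, n)`, `a_n` at
`(n, n + 1)`, `a_n^*` at `(n + 1, n)` (numbering from `1`), and zero elsewhere. -/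
def jacobiBlocks {m p : ℕ} (a : Fin (p - 1) → Matrix (Fin m) (Fin m) ℂ)
    (b : Fin p → Matrix (Fin m) (Fin m) ℂ) :
    Matrix (Fin p) (Fin p) (Matrix (Fin m) (Fin m) ℂ) :=
  Matrix.of fun n k =>
    if n = k then b n
    else if (k : ℕ) = n + 1 then offDiag a (n + 1)
    else if (n : ℕ) = k + 1 then (offDiag a (k + 1))ᴴ
    else 0

/-- The Jacobi operator `𝒥_{a,b}` as an `mp × mp` matrix. -/
def jacobi {m p : ℕ} (a : Fin (p - 1) → Matrix (Fin m) (Fin m) ℂ)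
    (b : Fin p → Matrix (Fin m) (Fin m) ℂ) : Matrix (Fin p × Fin m) (Fin p × Fin m) ℂ :=
  Matrix.comp (Fin p) (Fin p) (Fin m) (Fin m) ℂ (jacobiBlocks a b)

/-- The fundamental solution `φ_n(z)` of
`a_n y_{n+1} + b_n y_n + a_{n-1}^* y_{n-1} = z y_n`, `1 ≤ n ≤ p`, with `φ_0 = 0`, `φ_1 = I`. -/
def phi {m p : ℕ} (a : Fin (p - 1) → Matrix (Fin m) (Fin m) ℂ)
    (b : Fin p → Matrix (Fin m) (Fin m) ℂ) (z : ℂ) : ℕ → Matrix (Fin m) (Fin m) ℂ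
  | 0 => 0
  | 1 => 1
  | n + 2 => (offDiag a (n + 1))⁻¹ *
      (z • phi a b z (n + 1) - diag b (n + 1) * phi a b z (n + 1)
        - (offDiag a n)ᴴ * phi a b z n)

/-- The real eigenvalues of the Jacobi operator (all of its eigenvalues, if the `b_n` are
self-adjoint). -/
def eigenvalueSet {m p : ℕ} (a : Fin (p - 1) → Matrix (Fin m) (Fin m) ℂ)
    (b : Fin p → Matrix (Fin m) (Fin m) ℂ) : Set ℝ :=
  {x : ℝ | Module.End.HasEigenvalue (Matrix.toLin' (jacobi a b)) (x : ℂ)}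

theorem eigenvalueSet_finite {m p : ℕ} (a : Fin (p - 1) → Matrix (Fin m) (Fin m) ℂ)
    (b : Fin p → Matrix (Fin m) (Fin m) ℂ) : (eigenvalueSet a b).Finite :=
  (Module.End.finite_hasEigenvalue (Matrix.toLin' (jacobi a b))).preimage
    Complex.ofReal_injective.injOn

/-- The range of an `m × m` matrix, as a subspace of the Hilbert space `ℂ^m`. -/
abbrev ran {m : ℕ} (P : Matrix (Fin m) (Fin m) ℂ) : Submodule ℂ (EuclideanSpace ℂ (Fin m)) :=
  LinearMap.range (Matrix.toEuclideanLin P)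

/-- The matrix of the orthogonal projector of `ℂ^m` onto `Ker A`. -/
def kerProj {m : ℕ} (A : Matrix (Fin m) (Fin m) ℂ) : Matrix (Fin m) (Fin m) ℂ :=
  (Matrix.toEuclideanCLM (n := Fin m) (𝕜 := ℂ)).symm
    (LinearMap.ker (Matrix.toEuclideanLin A)).starProjection

/-- For a matrix of the form `P * S`, its restriction to an operator `Ran P → Ran P`. -/
def restrictRan {m : ℕ} (P S : Matrix (Fin m) (Fin m) ℂ) : ran P →ₗ[ℂ] ran P :=
  (Matrix.toEuclideanLin (P * S)).restrict (p := ran P) (q := ran P) fun x _ =>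
    ⟨Matrix.toEuclideanLin S x, by simp [Matrix.toLpLin_apply]⟩

/-- Tuples `(λ_j, P_j, g_j)`, `1 ≤ j ≤ N` (with `N` part of the datum), of real numbers,
`m × m` matrices and linear operators `g_j : Ran P_j → Ran P_j`. -/
@[ext] structure SpectralTuple (m : ℕ) where
  N : ℕ
  lam : Fin N → ℝ
  P : Fin N → Matrix (Fin m) (Fin m) ℂ
  g : (j : Fin N) → (ran (P j) →ₗ[ℂ] ran (P j))

/-- The mapping `Ψ : (a, b) ↦ (λ_j, P_j, g_j)`: the distinct eigenvalues of `𝒥_{a,b}` in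
increasing order, the orthogonal projectors onto `Ker φ_{p+1}(λ_j)`, and the restrictions of
`G_j = P_j (∑ φ_n(λ_j)^* φ_n(λ_j)) P_j`, `1 ≤ n ≤ p`, to `Ran P_j`. -/
def Psi {m p : ℕ} (ab : (Fin (p - 1) → Matrix (Fin m) (Fin m) ℂ) ×
    (Fin p → Matrix (Fin m) (Fin m) ℂ)) : SpectralTuple m :=
  let s : Finset ℝ := (eigenvalueSet_finite ab.1 ab.2).toFinset
  let lam : Fin s.card → ℝ := fun j => s.orderEmbOfFin rfl j
  let P : Fin s.card → Matrix (Fin m) (Fin m) ℂ :=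
    fun j => kerProj (phi ab.1 ab.2 (lam j) (p + 1))
  { N := s.card
    lam := lam
    P := P
    g := fun j => restrictRan (P j)
      ((∑ n ∈ Finset.Icc 1 p, (phi ab.1 ab.2 (lam j) n)ᴴ * phi ab.1 ab.2 (lam j) n) * P j) }

/-- The moments `T_s = ∑_j λ_j^s P_j`. -/
def moment {m N : ℕ} (lam : Fin N → ℝ) (P : Fin N → Matrix (Fin m) (Fin m) ℂ) (s : ℕ) :
    Matrix (Fin m) (Fin m) ℂ :=
  ∑ j, ((lam j : ℂ) ^ s) • P j

/-- `p`-tame systems of distinct real numbers `λ_j` and orthogonal projectors `P_j`. -/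
def IsTame {m N : ℕ} (p : ℕ) (lam : Fin N → ℝ) (P : Fin N → Matrix (Fin m) (Fin m) ℂ) : Prop :=
  Function.Injective lam ∧ (∀ j, IsStarProjection (P j)) ∧ ∑ j, (P j).rank = m * p ∧
    (Matrix.comp (Fin p) (Fin p) (Fin m) (Fin m) ℂ
      (Matrix.of fun s k : Fin p => moment lam P (s + k))).det ≠ 0

/-- `g = g^* > 0` for an operator on a subspace of `ℂ^m`. -/
def IsPosDefOp {m : ℕ} {E : Submodule ℂ (EuclideanSpace ℂ (Fin m))} (g : E →ₗ[ℂ] E) : Prop :=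
  (∀ v w : E, inner ℂ (g v) w = inner ℂ v (g w)) ∧
    ∀ v : E, v ≠ 0 → 0 < (inner ℂ (g v) v).re

/-- The operator `P g⁻¹ P` on `ℂ^m`, for `g : Ran P → Ran P` (used only for invertible `g`). -/
def sandwich {m : ℕ} (P : Matrix (Fin m) (Fin m) ℂ) (g : ran P →ₗ[ℂ] ran P) :
    EuclideanSpace ℂ (Fin m) →ₗ[ℂ] EuclideanSpace ℂ (Fin m) :=
  (ran P).subtype ∘ₗ (Ring.inverse g : Module.End ℂ (ran P)) ∘ₗ
    (Matrix.toEuclideanLin P).rangeRestrict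

/-- The set `𝒮_p` of spectral data. -/
def spectralDataSet (m p : ℕ) : Set (SpectralTuple m) :=
  {D | (p ≤ D.N ∧ D.N ≤ p * m) ∧ StrictMono D.lam ∧
    IsTame p D.lam D.P ∧ (∀ j, D.P j ≠ 0) ∧
    (∀ j, IsPosDefOp (D.g j)) ∧ ∑ j, sandwich (D.P j) (D.g j) = LinearMap.id}

/-- `S₊^{p-1} × S^p`: positive definite `a_n` and self-adjoint `b_n`. -/
def posDefPairs (m p : ℕ) : Set ((Fin (p - 1) → Matrix (Fin m) (Fin m) ℂ) ×
    (Fin p → Matrix (Fin m) (Fin m) ℂ)) :=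
  {ab | (∀ n, (ab.1 n).PosDef) ∧ ∀ n, (ab.2 n).IsHermitian}

/-- `L₊`: lower triangular matrices with (real) positive entries on the diagonal. -/
def IsLowerPos {m : ℕ} (A : Matrix (Fin m) (Fin m) ℂ) : Prop :=
  (∀ i j, i < j → A i j = 0) ∧ ∀ i, (A i i).im = 0 ∧ 0 < (A i i).re

/-- `L₊^{p-1} × S^p`: the `a_n` in `L₊` and self-adjoint `b_n`. -/
def lowerPosPairs (m p : ℕ) : Set ((Fin (p - 1) → Matrix (Fin m) (Fin m) ℂ) ×
    (Fin p → Matrix (Fin m) (Fin m) ℂ)) :=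
  {ab | (∀ n, IsLowerPos (ab.1 n)) ∧ ∀ n, (ab.2 n).IsHermitian}

end MatrixJacobi

end

/-!
A pair `(a, b)` is the same thing as a matrix-valued measure `∑ⱼ Wⱼ δ_{λⱼ}` with
`Wⱼ = Pⱼ gⱼ⁻¹ Pⱼ`, for which `φ_1, …, φ_p` are orthonormal. Write `Φⱼ` for the block column of
`φ_1(λⱼ), …, φ_p(λⱼ)`.

*From `(a, b)` to spectral data.* The eigenvectors of the Jacobi operator for `λⱼ` are exactly the
columns `Φⱼ v` with `φ_{p+1}(λⱼ) v = 0`, and the operator is self-adjoint, so that the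
spectral theorem reads `∑ⱼ Φⱼ Wⱼ Φⱼ^* = 1` (`isSpectralResolution_of_gram`). The first block of this identity
is `∑ⱼ Wⱼ = 1`; its trace gives `∑ⱼ rank Pⱼ = mp`. The triangular matrix of coefficients of the
`φ_n` carries the Hankel matrix of the moments of `Wⱼ` to the identity, and `Pⱼ`, `Wⱼ` have the same
kernel, so the Hankel matrix of the moments of `Pⱼ` is nondegenerate.

*Injectivity.* By induction on `n`, the measure determines `φ_n`, then `b_n = ⟨λ φ_n, φ_n⟩`, then
`a_n φ_{n+1}`, and then `a_n a_n^*`, the Gram matrix of `a_n φ_{n+1}`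
(`eq_of_isOrthonormalUpTo`). Positive definite `a_n` and lower triangular `a_n` with positive
diagonal are both determined by `a_n a_n^*`, which can be any positive definite matrix: the square
root and the Cholesky factorization. Nothing else about the two classes is used, and both parts of
the theorem are instances of `bijOn_Psi`.

*Surjectivity.* Given spectral data, run the same induction as a Gram–Schmidt process
(`exists_isOrthonormalUpTo`). The Gram matrices are positive definite because a vector polynomial of
degree less than `p` that vanishes almost everywhere is zero, by nondegeneracy of the Hankel matrix.
This yields `∑ⱼ Φⱼ Wⱼ Φⱼ^* = 1`. Since `∑ⱼ rank Pⱼ = mp`, the one-sided inverse is two-sided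
(`mul_mul_eq_ite_of_sum_mul_eq_one`): `Wᵢ Φᵢ^* Φⱼ Pⱼ = δᵢⱼ Pⱼ`. Hence `φ_{p+1}(λⱼ) Pⱼ = 0`, the `λⱼ`
are all the eigenvalues, `Pⱼ` projects onto the whole of `Ker φ_{p+1}(λⱼ)`, and
`Pⱼ Φⱼ^* Φⱼ Pⱼ` restricts to `gⱼ`.
-/

noncomputable section

namespace MatrixJacobi

open scoped Matrix ComplexOrder

/-! ### Unique factorization `S = A * Aᴴ` -/

/-- A class of invertible matrices that contains exactly one "square root" `A`, in the sense
`A * Aᴴ = S`, of each positive definite `S`. The positive definite matrices and the lower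
triangular matrices with positive diagonal are two such classes. -/
structure IsFactorClass {m : ℕ} (C : Matrix (Fin m) (Fin m) ℂ → Prop) : Prop where
  isUnit : ∀ A, C A → IsUnit A
  unique : ∀ A B, C A → C B → A * Aᴴ = B * Bᴴ → A = B
  exist : ∀ S : Matrix (Fin m) (Fin m) ℂ, S.PosDef → ∃ A, C A ∧ A * Aᴴ = S

section
open scoped MatrixOrder Matrix.Norms.L2Operator

theorem isFactorClass_posDef (m : ℕ) :
    IsFactorClass (fun A : Matrix (Fin m) (Fin m) ℂ => A.PosDef) where
  isUnit A hA := hA.isUnit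
  unique A B hA hB h := by
    rw [hA.isHermitian.eq, hB.isHermitian.eq] at h
    exact (CFC.mul_self_eq_mul_self_iff A B hA.posSemidef.nonneg hB.posSemidef.nonneg).1 h
  exist S hS := by
    have h0 : (0 : Matrix (Fin m) (Fin m) ℂ) ≤ S := hS.posSemidef.nonneg
    have h1 : CFC.sqrt S * CFC.sqrt S = S := CFC.sqrt_mul_sqrt_self S h0
    have h2 : (CFC.sqrt S).PosSemidef := Matrix.nonneg_iff_posSemidef.1 (CFC.sqrt_nonneg S)
    refine ⟨CFC.sqrt S, ?_, by rw [h2.isHermitian.eq, h1]⟩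
    rw [h2.posDef_iff_isUnit]
    have : IsUnit (CFC.sqrt S * CFC.sqrt S) := by rw [h1]; exact hS.isUnit
    exact isUnit_of_mul_isUnit_left this

end

theorem IsLowerPos.isUnit {m : ℕ} {A : Matrix (Fin m) (Fin m) ℂ} (hA : IsLowerPos A) :
    IsUnit A := by
  rw [Matrix.isUnit_iff_isUnit_det, isUnit_iff_ne_zero, Matrix.det_of_isLowerTriangular A
    (fun i j h => hA.1 i j h)]
  refine Finset.prod_ne_zero_iff.2 fun i _ h => ?_
  have := (hA.2 i).2
  simp [h] at this

/-- Uniqueness of the Cholesky factor: `B⁻¹ * A` is unitary and lower triangular, hence diagonal,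
and its diagonal entries are positive and of modulus one. -/
theorem IsLowerPos.eq_of_mul_conjTranspose_eq {m : ℕ} {A B : Matrix (Fin m) (Fin m) ℂ}
    (hA : IsLowerPos A) (hB : IsLowerPos B) (h : A * Aᴴ = B * Bᴴ) : A = B := by
  have triInv : ∀ M : Matrix (Fin m) (Fin m) ℂ, IsUnit M → (∀ i j, i < j → M i j = 0) →
      ∀ i j, i < j → M⁻¹ i j = 0 := by
    intro M hM hl i j hij
    have : Invertible M := hM.invertible
    have hb : M.BlockTriangular OrderDual.toDual := fun i j h => hl i j h
    exact Matrix.blockTriangular_inv_of_blockTriangular hb hij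
  have uA := hA.isUnit
  have uB := hB.isUnit
  have uB' : IsUnit B.det := (Matrix.isUnit_iff_isUnit_det B).1 uB
  have uBH : IsUnit Bᴴ.det := by
    rw [Matrix.det_conjTranspose]; exact uB'.star
  set c := B⁻¹ * A with hc
  have hAc : A = B * c := by rw [hc, Matrix.mul_nonsing_inv_cancel_left _ _ uB']
  have hcc : c * cᴴ = 1 := by
    rw [hc, Matrix.conjTranspose_mul, Matrix.mul_assoc, ← Matrix.mul_assoc A, h,
      Matrix.conjTranspose_nonsing_inv, Matrix.mul_assoc, Matrix.mul_nonsing_inv _ uBH,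
      Matrix.mul_one, Matrix.nonsing_inv_mul _ uB']
  have hcl : ∀ i j, i < j → c i j = 0 := by
    intro i j hij
    have hB' : (B⁻¹).BlockTriangular OrderDual.toDual := fun i j h => triInv B uB hB.1 i j h
    have hA' : A.BlockTriangular OrderDual.toDual := fun i j h => hA.1 i j h
    exact (hB'.mul hA') hij
  have hcinv : c⁻¹ = cᴴ := Matrix.inv_eq_right_inv hcc
  have hcd : ∀ i j, i ≠ j → c i j = 0 := by
    intro i j hij
    rcases lt_or_gt_of_ne hij with h | h
    · exact hcl i j h
    · have uc : IsUnit c := IsUnit.of_mul_eq_one _ hcc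
      have := triInv c uc hcl j i h
      rw [hcinv, Matrix.conjTranspose_apply, star_eq_zero] at this
      exact this
  have hcdiag : c = Matrix.diagonal (fun i => c i i) := by
    ext i j
    by_cases hij : i = j
    · subst hij; simp
    · rw [Matrix.diagonal_apply_ne _ hij, hcd i j hij]
  have hone : ∀ i, c i i = 1 := by
    intro i
    have h1 : c i i * star (c i i) = 1 := by
      have := congrFun (congrFun hcc i) i
      rw [hcdiag, Matrix.diagonal_conjTranspose, Matrix.diagonal_mul_diagonal] at this
      simpa using this
    have h2 : A i i = B i i * c i i := by
      conv_lhs => rw [hAc, hcdiag, Matrix.mul_diagonal]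
    obtain ⟨a0, a1⟩ := hA.2 i
    obtain ⟨b0, b1⟩ := hB.2 i
    have e1 := congrArg Complex.im h2
    have e2 := congrArg Complex.re h2
    have e3 := congrArg Complex.re h1
    simp only [Complex.mul_im, Complex.mul_re, b0, a0, zero_mul, sub_zero, add_zero] at e1 e2
    have im0 : (c i i).im = 0 := by
      rcases mul_eq_zero.1 e1.symm with h | h
      · exact absurd h b1.ne'
      · exact h
    have re0 : 0 < (c i i).re := by
      by_contra hneg
      nlinarith [not_lt.1 hneg]
    simp [im0] at e3
    have : (c i i).re = 1 := by nlinarith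
    exact Complex.ext this im0
  have : c = 1 := by rw [hcdiag]; simp [hone]
  rw [hAc, this, Matrix.mul_one]

/-- Existence of the Cholesky factorization. -/
theorem exists_isLowerPos_mul_conjTranspose_eq {m : ℕ} {S : Matrix (Fin m) (Fin m) ℂ}
    (hS : S.PosDef) : ∃ A, IsLowerPos A ∧ A * Aᴴ = S := by
  -- `U` is the inverse factor of the LDL decomposition `S = U⁻¹ D (U⁻¹)ᴴ`; the unimodular `v i` below
  -- make the diagonal of `U⁻¹ √D` positive
  set U := LDL.lowerInv hS with hU
  have hUl : ∀ i j, i < j → U i j = 0 := fun i j h => LDL.lowerInv_triangular hS h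
  have hL : ∀ i j, i < j → U⁻¹ i j = 0 := by
    intro i j hij
    have hb : U.BlockTriangular OrderDual.toDual := fun i j h => hUl i j h
    exact Matrix.blockTriangular_inv_of_blockTriangular hb hij
  have hUu : IsUnit U := isUnit_of_invertible U
  have hD : (LDL.diag hS).PosDef := by
    rw [LDL.diag_eq_lowerInv_conj]
    exact (Matrix.IsUnit.posDef_star_right_conjugate_iff hUu).2 hS
  have hd : ∀ i, 0 < LDL.diagEntries hS i := by
    rw [LDL.diag] at hD
    exact Matrix.posDef_diagonal_iff.1 hD
  set r : Fin m → ℝ := fun i => Real.sqrt (LDL.diagEntries hS i).re with hr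
  have hr0 : ∀ i, 0 < r i := fun i => Real.sqrt_pos.2 (Complex.pos_iff.1 (hd i)).1
  have hrr : ∀ i, (r i : ℂ) * (r i : ℂ) = LDL.diagEntries hS i := by
    intro i
    obtain ⟨h1, h2⟩ := Complex.pos_iff.1 (hd i)
    rw [← Complex.ofReal_mul, Real.mul_self_sqrt h1.le]
    exact Complex.ext (by simp) (by simp [← h2])
  have hLdet : ∀ i, U⁻¹ i i ≠ 0 := by
    have h1 : IsUnit (U⁻¹).det := by
      exact (Matrix.isUnit_iff_isUnit_det _).1 ((Matrix.isUnit_nonsing_inv_iff).2 hUu)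
    rw [isUnit_iff_ne_zero, Matrix.det_of_isLowerTriangular _ (fun i j h => hL i j h)] at h1
    exact fun i => Finset.prod_ne_zero_iff.1 h1 i (Finset.mem_univ i)
  set v : Fin m → ℂ := fun i => star (U⁻¹ i i) / (‖U⁻¹ i i‖ : ℂ) with hv
  have hvv : ∀ i, v i * star (v i) = 1 := by
    intro i
    have h0 : (‖U⁻¹ i i‖ : ℂ) ≠ 0 := by simpa using hLdet i
    have h3 : star (U⁻¹ i i) * U⁻¹ i i = (‖U⁻¹ i i‖ : ℂ) * ‖U⁻¹ i i‖ := by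
      have := Complex.mul_conj' (U⁻¹ i i)
      rw [mul_comm, ← pow_two]; exact this
    simp only [hv, star_div₀, star_star]
    rw [show star (‖U⁻¹ i i‖ : ℂ) = (‖U⁻¹ i i‖ : ℂ) from Complex.conj_ofReal _,
      div_mul_div_comm, h3]
    exact div_self (mul_ne_zero h0 h0)
  refine ⟨U⁻¹ * Matrix.diagonal (fun i => (r i : ℂ) * v i), ⟨?_, ?_⟩, ?_⟩
  · intro i j hij
    rw [Matrix.mul_diagonal, hL i j hij, zero_mul]
  · intro i
    have h0 : (‖U⁻¹ i i‖ : ℂ) ≠ 0 := by simpa using hLdet i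
    have : (U⁻¹ * Matrix.diagonal (fun i => (r i : ℂ) * v i)) i i =
        ((r i * ‖U⁻¹ i i‖ : ℝ) : ℂ) := by
      rw [Matrix.mul_diagonal]
      have h3 : U⁻¹ i i * star (U⁻¹ i i) = (‖U⁻¹ i i‖ : ℂ) * ‖U⁻¹ i i‖ := by
        have := Complex.mul_conj' (U⁻¹ i i)
        rw [← pow_two]; exact this
      simp only [hv]
      rw [mul_left_comm, mul_div_assoc', h3, mul_div_assoc, div_self h0, mul_one]
      push_cast; rfl
    rw [this]
    exact ⟨Complex.ofReal_im _, by
      rw [Complex.ofReal_re]; exact mul_pos (hr0 i) (norm_pos_iff.2 (hLdet i))⟩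
  · rw [Matrix.conjTranspose_mul, Matrix.mul_assoc, ← Matrix.mul_assoc (Matrix.diagonal _),
      Matrix.diagonal_conjTranspose, Matrix.diagonal_mul_diagonal]
    conv_rhs => rw [← LDL.lower_conj_diag hS]
    rw [LDL.lower, LDL.diag, ← hU, Matrix.mul_assoc]
    congr 3
    funext i
    have h4 : star (r i : ℂ) = r i := Complex.conj_ofReal _
    rw [Pi.star_apply, star_mul', h4, mul_mul_mul_comm, hvv, mul_one, hrr]

theorem isFactorClass_isLowerPos (m : ℕ) :
    IsFactorClass (IsLowerPos (m := m)) where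
  isUnit _ hA := hA.isUnit
  unique _ _ hA hB h := hA.eq_of_mul_conjTranspose_eq hB h
  exist _ hS := exists_isLowerPos_mul_conjTranspose_eq hS

/-! ### One-sided inverses between spaces of equal dimension -/

/-- If `∑ⱼ Φⱼ Ψⱼ = 1`, where `Ψⱼ` takes values in the range of `Pⱼ` and the ranks
of the `Pⱼ` add up to the size of the identity, then the family `(Ψⱼ)` is also a left inverse of
`(Φⱼ)` on `⨁ⱼ Ran Pⱼ`: a one-sided inverse between spaces of equal dimension is two-sided. -/
theorem mul_mul_eq_ite_of_sum_mul_eq_one {ι n m : Type*} [Fintype ι] [DecidableEq ι] [Fintype n]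
    [DecidableEq n] [Fintype m] [DecidableEq m] (Φ : ι → Matrix n m ℂ) (Ψ : ι → Matrix m n ℂ)
    (P : ι → Matrix m m ℂ) (hPΨ : ∀ j, P j * Ψ j = Ψ j)
    (h : ∑ j, Φ j * Ψ j = 1) (hr : ∑ j, (P j).rank = Fintype.card n) (i j : ι) :
    Ψ i * Φ j * P j = if i = j then P j else 0 := by
  let R : ι → Submodule ℂ (m → ℂ) := fun j => LinearMap.range (P j).mulVecLin
  let X : (Π j, R j) →ₗ[ℂ] (n → ℂ) := ∑ j, (Φ j).mulVecLin ∘ₗ (R j).subtype ∘ₗ LinearMap.proj j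
  let Y : (n → ℂ) →ₗ[ℂ] (Π j, R j) := LinearMap.pi fun j =>
    (Ψ j).mulVecLin.codRestrict (R j) fun u => ⟨Ψ j *ᵥ u, by
      simp [Matrix.mulVec_mulVec, hPΨ]⟩
  have hX : ∀ v, X v = ∑ j, Φ j *ᵥ (v j : m → ℂ) := by intro v; simp [X]
  have hY : ∀ u j, (Y u j : m → ℂ) = Ψ j *ᵥ u := fun _ _ => rfl
  have hXY : ∀ u, X (Y u) = u := by
    intro u
    rw [hX]
    simp only [hY, Matrix.mulVec_mulVec]
    rw [← Matrix.sum_mulVec, h, Matrix.one_mulVec]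
  have hdim : Module.finrank ℂ (Π j, R j) = Module.finrank ℂ (n → ℂ) := by
    rw [Module.finrank_pi_fintype, Module.finrank_fintype_fun_eq_card, ← hr]
    rfl
  have hinj : Function.Injective X :=
    (LinearMap.injective_iff_surjective_of_finrank_eq_finrank hdim).2 fun u => ⟨Y u, hXY u⟩
  have hYX : ∀ v, Y (X v) = v := fun v => hinj (hXY (X v))
  apply Matrix.ext_of_mulVec_single
  intro k
  set w : m → ℂ := P j *ᵥ Pi.single k 1 with hw
  let v : Π j, R j := Pi.single j ⟨w, ⟨Pi.single k 1, rfl⟩⟩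
  have hv : X v = Φ j *ᵥ w := by
    rw [hX, Finset.sum_eq_single j]
    · simp [v]
    · intro l _ hl
      simp [v, Pi.single_eq_of_ne hl]
    · simp
  have h1 := congrArg (Subtype.val) (congrFun (hYX v) i)
  rw [hY, hv, Matrix.mulVec_mulVec, hw, Matrix.mulVec_mulVec] at h1
  rw [h1]
  by_cases hij : i = j
  · subst hij; simp [v, hw]
  · ext; simp [v, hij]

/-! ### Operators on `Ran P` as matrices -/

/-- The matrix of `P g P` on `ℂ^m`, for an operator `g : Ran P → Ran P`. -/
def liftRan {m : ℕ} (P : Matrix (Fin m) (Fin m) ℂ) (g : ran P →ₗ[ℂ] ran P) :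
    Matrix (Fin m) (Fin m) ℂ :=
  Matrix.toEuclideanLin.symm
    ((ran P).subtype ∘ₗ g ∘ₗ (Matrix.toEuclideanLin P).rangeRestrict)

/-- The weight `P g⁻¹ P` attached to an eigenvalue, as a matrix. -/
def weight {m : ℕ} (P : Matrix (Fin m) (Fin m) ℂ) (g : ran P →ₗ[ℂ] ran P) :
    Matrix (Fin m) (Fin m) ℂ :=
  liftRan P (Ring.inverse g : Module.End ℂ (ran P))

section liftRan

variable {m : ℕ} {P : Matrix (Fin m) (Fin m) ℂ}

theorem toEuclideanLin_liftRan (g : ran P →ₗ[ℂ] ran P) :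
    Matrix.toEuclideanLin (liftRan P g) =
      (ran P).subtype ∘ₗ g ∘ₗ (Matrix.toEuclideanLin P).rangeRestrict := by
  simp only [liftRan, LinearEquiv.apply_symm_apply]

theorem toEuclideanLin_liftRan_apply (g : ran P →ₗ[ℂ] ran P) (x : EuclideanSpace ℂ (Fin m)) :
    Matrix.toEuclideanLin (liftRan P g) x = g ((Matrix.toEuclideanLin P).rangeRestrict x) := by
  rw [toEuclideanLin_liftRan]; rfl

theorem sandwich_eq_toEuclideanLin_weight (g : ran P →ₗ[ℂ] ran P) :
    sandwich P g = Matrix.toEuclideanLin (weight P g) := by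
  rw [weight, toEuclideanLin_liftRan]; rfl

theorem toEuclideanLin_mul_apply (A B : Matrix (Fin m) (Fin m) ℂ) (x : EuclideanSpace ℂ (Fin m)) :
    Matrix.toEuclideanLin (A * B) x = Matrix.toEuclideanLin A (Matrix.toEuclideanLin B x) := by
  simp [Matrix.toLpLin_apply]

theorem toEuclideanLin_apply_of_mem_ran (hP : P * P = P) {x : EuclideanSpace ℂ (Fin m)}
    (hx : x ∈ ran P) : Matrix.toEuclideanLin P x = x := by
  obtain ⟨y, rfl⟩ := hx
  rw [← toEuclideanLin_mul_apply, hP]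

theorem coe_rangeRestrict_toEuclideanLin (x : EuclideanSpace ℂ (Fin m)) :
    ((Matrix.toEuclideanLin P).rangeRestrict x : EuclideanSpace ℂ (Fin m)) =
      Matrix.toEuclideanLin P x := rfl

theorem rangeRestrict_apply_coe (hP : P * P = P) (x : ran P) :
    (Matrix.toEuclideanLin P).rangeRestrict (x : EuclideanSpace ℂ (Fin m)) = x :=
  Subtype.ext (toEuclideanLin_apply_of_mem_ran hP x.2)

theorem toEuclideanLin_liftRan_coe (hP : P * P = P) (g : ran P →ₗ[ℂ] ran P) (x : ran P) :
    Matrix.toEuclideanLin (liftRan P g) x = g x := by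
  rw [toEuclideanLin_liftRan_apply, rangeRestrict_apply_coe hP]

theorem ext_toEuclideanLin {A B : Matrix (Fin m) (Fin m) ℂ}
    (h : ∀ x, Matrix.toEuclideanLin A x = Matrix.toEuclideanLin B x) : A = B :=
  Matrix.toEuclideanLin.injective (LinearMap.ext h)

theorem mul_liftRan (hP : P * P = P) (g : ran P →ₗ[ℂ] ran P) : P * liftRan P g = liftRan P g := by
  refine ext_toEuclideanLin fun x => ?_
  rw [toEuclideanLin_mul_apply, toEuclideanLin_liftRan_apply,
    toEuclideanLin_apply_of_mem_ran hP (Subtype.mem _)]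

theorem liftRan_mul (hP : P * P = P) (g : ran P →ₗ[ℂ] ran P) : liftRan P g * P = liftRan P g := by
  refine ext_toEuclideanLin fun x => ?_
  rw [toEuclideanLin_mul_apply, toEuclideanLin_liftRan_apply, toEuclideanLin_liftRan_apply,
    ← coe_rangeRestrict_toEuclideanLin, rangeRestrict_apply_coe hP]

theorem liftRan_mul_liftRan (hP : P * P = P) (g h : Module.End ℂ (ran P)) :
    liftRan P g * liftRan P h = liftRan P (g * h) := by
  refine ext_toEuclideanLin fun x => ?_
  rw [toEuclideanLin_mul_apply, toEuclideanLin_liftRan_apply, toEuclideanLin_liftRan_apply,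
    toEuclideanLin_liftRan_apply, rangeRestrict_apply_coe hP]
  rfl

theorem liftRan_one : liftRan P (1 : Module.End ℂ (ran P)) = P := by
  refine ext_toEuclideanLin fun x => ?_
  rw [toEuclideanLin_liftRan_apply]
  rfl

theorem liftRan_injective (hP : P * P = P) : Function.Injective (liftRan P) := by
  intro g h hgh
  ext1 x
  apply Subtype.ext
  rw [← toEuclideanLin_liftRan_coe hP, hgh, toEuclideanLin_liftRan_coe hP]

theorem liftRan_restrictRan (S : Matrix (Fin m) (Fin m) ℂ) :
    liftRan P (restrictRan P S) = P * S * P := by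
  refine ext_toEuclideanLin fun x => ?_
  rw [toEuclideanLin_liftRan_apply, toEuclideanLin_mul_apply]
  rfl

theorem inner_coe_ran (hP : P * P = P) (hPH : P.IsHermitian) (u : ran P)
    (y : EuclideanSpace ℂ (Fin m)) :
    inner ℂ (u : EuclideanSpace ℂ (Fin m)) y =
      inner ℂ u ((Matrix.toEuclideanLin P).rangeRestrict y) := by
  rw [Submodule.coe_inner, coe_rangeRestrict_toEuclideanLin,
    ← Matrix.isSymmetric_toEuclideanLin_iff.2 hPH, toEuclideanLin_apply_of_mem_ran hP u.2]

theorem isHermitian_liftRan (hP : P * P = P) (hPH : P.IsHermitian) {g : ran P →ₗ[ℂ] ran P}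
    (hg : IsPosDefOp g) : (liftRan P g).IsHermitian := by
  rw [← Matrix.isSymmetric_toEuclideanLin_iff]
  intro x y
  rw [toEuclideanLin_liftRan_apply, toEuclideanLin_liftRan_apply, inner_coe_ran hP hPH, hg.1,
    ← inner_conj_symm x, inner_coe_ran hP hPH]
  exact (inner_conj_symm (𝕜 := ℂ) ((Matrix.toEuclideanLin P).rangeRestrict x)
    (g ((Matrix.toEuclideanLin P).rangeRestrict y))).symm

theorem posSemidef_liftRan (hP : P * P = P) (hPH : P.IsHermitian) {g : ran P →ₗ[ℂ] ran P}
    (hg : IsPosDefOp g) : (liftRan P g).PosSemidef := by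
  rw [← Matrix.isPositive_toEuclideanLin_iff]
  refine ⟨Matrix.isSymmetric_toEuclideanLin_iff.2 (isHermitian_liftRan hP hPH hg), fun x => ?_⟩
  rw [toEuclideanLin_liftRan_apply, inner_coe_ran hP hPH]
  by_cases h0 : (Matrix.toEuclideanLin P).rangeRestrict x = 0
  · simp [h0]
  · exact (hg.2 _ h0).le

/-- A pair `(G, W)` of positive semidefinite matrices that vanish on the orthogonal complement of
`Ran P` and are inverse to each other on `Ran P`. -/
structure IsInversePairOn (P G W : Matrix (Fin m) (Fin m) ℂ) : Prop where
  proj_mul_proj : P * P = P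
  proj_herm : Pᴴ = P
  proj_mul_weight : P * W = W
  weight_mul_proj : W * P = W
  gram_mul_proj : G * P = G
  gram_mul_weight : G * W = P
  weight_mul_gram : W * G = P
  weight_posSemidef : W.PosSemidef

theorem IsInversePairOn.weight_herm {G W : Matrix (Fin m) (Fin m) ℂ}
    (h : IsInversePairOn P G W) : Wᴴ = W :=
  h.weight_posSemidef.isHermitian.eq

theorem posSemidef_of_inverse_on {G W : Matrix (Fin m) (Fin m) ℂ} (hG : G.PosSemidef)
    (hPH : Pᴴ = P) (hPW : P * W = W) (hGW : G * W = P) (hWG : W * G = P) : W.PosSemidef := by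
  have h1 : Wᴴ * P = Wᴴ := by
    conv_lhs => rw [← hPH, ← Matrix.conjTranspose_mul, hPW]
  have h2 : Wᴴ * G = P := by
    rw [← hG.isHermitian.eq, ← Matrix.conjTranspose_mul, hGW, hPH]
  have hWH : Wᴴ = W := by
    rw [← h1]
    conv_lhs => rw [← hGW, ← Matrix.mul_assoc, h2, hPW]
  have h3 : W = Wᴴ * G * W := by rw [hWH, hWG, hPW]
  rw [h3]
  exact hG.conjTranspose_mul_mul_same _

theorem IsPosDefOp.isUnit {E : Submodule ℂ (EuclideanSpace ℂ (Fin m))} {g : E →ₗ[ℂ] E}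
    (hg : IsPosDefOp g) : IsUnit (g : Module.End ℂ E) := by
  rw [Module.End.isUnit_iff]
  have hinj : Function.Injective g := by
    rw [← LinearMap.ker_eq_bot, LinearMap.ker_eq_bot']
    intro v hv
    by_contra h0
    have := hg.2 v h0
    simp [hv] at this
  exact ⟨hinj, LinearMap.injective_iff_surjective.1 hinj⟩

theorem isInversePairOn_liftRan_weight (hP : IsStarProjection P) {g : ran P →ₗ[ℂ] ran P}
    (hg : IsPosDefOp g) : IsInversePairOn P (liftRan P g) (weight P g) := by
  have hPP : P * P = P := hP.isIdempotentElem
  have hPH : Pᴴ = P := hP.isSelfAdjoint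
  have hGW : liftRan P g * weight P g = P := by
    rw [weight, liftRan_mul_liftRan hPP, Ring.mul_inverse_cancel _ hg.isUnit, liftRan_one]
  have hWG : weight P g * liftRan P g = P := by
    rw [weight, liftRan_mul_liftRan hPP, Ring.inverse_mul_cancel _ hg.isUnit, liftRan_one]
  have hPW : P * weight P g = weight P g := mul_liftRan hPP _
  have hWP : weight P g * P = weight P g := liftRan_mul hPP _
  have hG := isHermitian_liftRan hPP hPH hg
  exact ⟨hPP, hPH, hPW, hWP, liftRan_mul hPP _, hGW, hWG,
    posSemidef_of_inverse_on (posSemidef_liftRan hPP hPH hg) hPH hPW hGW hWG⟩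

end liftRan

/-! ### Block columns and the Jacobi operator -/

section blockCol

variable {m p : ℕ} {κ : Type*}

/-- The column of the blocks `U 1, …, U p`. -/
def blockCol (p : ℕ) (U : ℕ → Matrix (Fin m) κ ℂ) : Matrix (Fin p × Fin m) κ ℂ :=
  Matrix.of fun x k => U (x.1 + 1) x.2 k

theorem blockCol_mul {ι : Type*} [Fintype κ] (U : ℕ → Matrix (Fin m) κ ℂ) (A : Matrix κ ι ℂ) :
    blockCol p U * A = blockCol p (fun n => U n * A) := rfl

theorem blockCol_congr {U V : ℕ → Matrix (Fin m) κ ℂ} (h : ∀ n, 1 ≤ n → n ≤ p → U n = V n) :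
    blockCol p U = blockCol p V := by
  ext ⟨n, i⟩ k
  simp only [blockCol, Matrix.of_apply]
  rw [h _ (by omega) (by omega)]

theorem conjTranspose_blockCol_mul_blockCol {ι : Type*} (U : ℕ → Matrix (Fin m) κ ℂ)
    (V : ℕ → Matrix (Fin m) ι ℂ) :
    (blockCol p U)ᴴ * blockCol p V = ∑ n ∈ Finset.Icc 1 p, (U n)ᴴ * V n := by
  ext i k
  rw [Matrix.sum_apply, Matrix.mul_apply, Fintype.sum_prod_type, ← Finset.Ico_add_one_right_eq_Icc,
    Finset.sum_Ico_eq_sum_range, Finset.sum_range]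
  refine Finset.sum_congr rfl fun n _ => ?_
  simp only [Matrix.mul_apply, blockCol, Matrix.conjTranspose_apply, Matrix.of_apply,
    add_comm 1 (n : ℕ)]

theorem sum_blockCol_mul_eq_one_iff {ι : Type*} [Fintype ι]
    (U V : ι → ℕ → Matrix (Fin m) (Fin m) ℂ) (W : ι → Matrix (Fin m) (Fin m) ℂ) :
    ∑ j, blockCol p (U j) * (W j * (blockCol p (V j))ᴴ) = 1 ↔
      ∀ n l, 1 ≤ n → n ≤ p → 1 ≤ l → l ≤ p →
        ∑ j, U j n * W j * (V j l)ᴴ = if n = l then 1 else 0 := by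
  have entry : ∀ (n l : Fin p) (i k : Fin m),
      (∑ j, blockCol p (U j) * (W j * (blockCol p (V j))ᴴ)) (n, i) (l, k) =
        (∑ j, U j (n + 1) * W j * (V j (l + 1))ᴴ) i k := by
    intro n l i k
    rw [Matrix.sum_apply, Matrix.sum_apply]
    refine Finset.sum_congr rfl fun j _ => ?_
    rw [Matrix.mul_assoc]
    rfl
  constructor
  · intro h n l hn hn' hl hl'
    ext i k
    have := entry ⟨n - 1, by omega⟩ ⟨l - 1, by omega⟩ i k
    simp only [Nat.sub_add_cancel hn, Nat.sub_add_cancel hl] at this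
    rw [← this, h, Matrix.one_apply]
    by_cases hnl : n = l
    · subst hnl; simp [Matrix.one_apply]
    · have : n - 1 ≠ l - 1 := by omega
      simp [hnl, this]
  · intro h
    ext ⟨n, i⟩ ⟨l, k⟩
    rw [entry, h _ _ (by omega) (by omega) (by omega) (by omega), Matrix.one_apply]
    by_cases hnl : n = l
    · subst hnl; simp [Matrix.one_apply]
    · have : (n : ℕ) ≠ l := fun h => hnl (Fin.ext h)
      simp [hnl, this]

theorem jacobi_mul_blockCol (a : Fin (p - 1) → Matrix (Fin m) (Fin m) ℂ)
    (b : Fin p → Matrix (Fin m) (Fin m) ℂ) (U : ℕ → Matrix (Fin m) κ ℂ) (h0 : U 0 = 0)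
    (hp : U (p + 1) = 0) :
    jacobi a b * blockCol p U = blockCol p (fun n =>
      offDiag a n * U (n + 1) + diag b n * U n + (offDiag a (n - 1))ᴴ * U (n - 1)) := by
  have hsum : ∀ n : Fin p, ∑ l : Fin p, jacobiBlocks a b n l * U (l + 1) =
      offDiag a (n + 1) * U (n + 1 + 1) + diag b (n + 1) * U (n + 1) +
        (offDiag a (n + 1 - 1))ᴴ * U (n + 1 - 1) := by
    intro n
    have hs : ∀ l : Fin p, jacobiBlocks a b n l * U (l + 1) =
        (if (l : ℕ) = n + 1 then offDiag a (n + 1) * U (n + 1 + 1) else 0) +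
        (if n = l then diag b (n + 1) * U (n + 1) else 0) +
        (if (n : ℕ) = l + 1 then (offDiag a n)ᴴ * U n else 0) := by
      intro l
      have hb : diag b (n + 1) = b n := by
        rw [diag, dif_pos (by omega)]; rfl
      simp only [jacobiBlocks, Matrix.of_apply]
      by_cases h1 : n = l
      · subst h1; simp [hb]
      · have h1' : (n : ℕ) ≠ l := fun h => h1 (Fin.ext h)
        by_cases h2 : (l : ℕ) = n + 1
        · have h3 : ¬ (n : ℕ) = l + 1 := by omega
          simp [h1, h2, show ¬ (n : ℕ) = n + 1 + 1 by omega]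
        · by_cases h3 : (n : ℕ) = l + 1
          · simp [h1, h3, show ¬ (l : ℕ) = l + 1 + 1 by omega]
          · simp [h1, h2, h3]
    simp only [hs, Finset.sum_add_distrib, Nat.add_sub_cancel]
    congr 1
    · congr 1
      · by_cases hn : (n : ℕ) + 1 < p
        · rw [Finset.sum_eq_single (⟨n + 1, hn⟩ : Fin p)]
          · simp
          · intro l _ hl
            rw [if_neg fun h => hl (Fin.ext h)]
          · simp
        · have : (n : ℕ) + 1 = p := by omega
          rw [this, hp, Matrix.mul_zero]
          simp
      · simp
    · by_cases hn : (n : ℕ) = 0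
      · rw [hn, h0]; simp
      · rw [Finset.sum_eq_single (⟨n - 1, by omega⟩ : Fin p)]
        · rw [if_pos]; simp; omega
        · intro l _ hl
          rw [if_neg fun h => hl (Fin.ext (by simp; omega))]
        · simp
  ext ⟨n, i⟩ k
  have h1 := congrFun (congrFun (hsum n) i) k
  rw [Matrix.sum_apply] at h1
  rw [Matrix.mul_apply, Fintype.sum_prod_type]
  simp only [blockCol, Matrix.of_apply]
  rw [← h1]
  refine Finset.sum_congr rfl fun l _ => ?_
  rw [Matrix.mul_apply]
  rfl

end blockCol

theorem isHermitian_jacobi {m p : ℕ} (a : Fin (p - 1) → Matrix (Fin m) (Fin m) ℂ)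
    (b : Fin p → Matrix (Fin m) (Fin m) ℂ) (hb : ∀ n, (b n).IsHermitian) :
    (jacobi a b).IsHermitian := by
  ext ⟨n, i⟩ ⟨l, k⟩
  have h : (jacobiBlocks a b l n)ᴴ = jacobiBlocks a b n l := by
    simp only [jacobiBlocks, Matrix.of_apply]
    by_cases h1 : n = l
    · subst h1; simp [(hb n).eq]
    · by_cases h2 : (l : ℕ) = n + 1
      · have h3 : ¬ (n : ℕ) = l + 1 := by omega
        simp [h1, Ne.symm h1, h2, show ¬ (n : ℕ) = n + 1 + 1 by omega]
      · by_cases h3 : (n : ℕ) = l + 1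
        · simp [h1, Ne.symm h1, h3, show ¬ (l : ℕ) = l + 1 + 1 by omega]
        · simp [h1, Ne.symm h1, h2, h3]
  rw [Matrix.conjTranspose_apply]
  exact congrFun (congrFun h i) k

/-! ### The fundamental solution as a matrix polynomial -/

section phi

variable {m p : ℕ} {κ : Type*} (a : Fin (p - 1) → Matrix (Fin m) (Fin m) ℂ)
  (b : Fin p → Matrix (Fin m) (Fin m) ℂ)

theorem phi_zero (z : ℂ) : phi a b z 0 = 0 := by rw [phi]

theorem phi_one (z : ℂ) : phi a b z 1 = 1 := by rw [phi]

variable {a b}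

theorem offDiag_zero : offDiag a 0 = 1 := by simp [offDiag]

theorem offDiag_self : offDiag a p = 1 := by simp [offDiag]

theorem isUnit_offDiag (ha : ∀ n, IsUnit (a n)) (n : ℕ) : IsUnit (offDiag a n) := by
  unfold offDiag
  split_ifs with h
  · exact ha _
  · exact isUnit_one

theorem offDiag_mul_phi {n : ℕ} (ha : IsUnit (offDiag a n)) (hn : 1 ≤ n) (z : ℂ) :
    offDiag a n * phi a b z (n + 1) = z • phi a b z n - diag b n * phi a b z n
      - (offDiag a (n - 1))ᴴ * phi a b z (n - 1) := by
  obtain ⟨n, rfl⟩ := Nat.exists_eq_add_of_le' hn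
  rw [phi, Matrix.mul_nonsing_inv_cancel_left _ _ ((Matrix.isUnit_iff_isUnit_det _).1 ha),
    Nat.add_sub_cancel]

/-- Every solution of the three-term recursion that vanishes at `0` is `φ_n(z) U₁`. -/
theorem eq_phi_mul_of_recursion (ha : ∀ n, IsUnit (a n)) (z : ℂ) (U : ℕ → Matrix (Fin m) κ ℂ)
    (h0 : U 0 = 0)
    (h : ∀ n, 1 ≤ n → n ≤ p → offDiag a n * U (n + 1) + diag b n * U n +
      (offDiag a (n - 1))ᴴ * U (n - 1) = z • U n) :
    ∀ n, n ≤ p + 1 → U n = phi a b z n * U 1 := by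
  intro n
  induction n using Nat.strong_induction_on with
  | _ n ih =>
    intro hn
    match n, ih, hn with
    | 0, _, _ => rw [h0, phi_zero, Matrix.zero_mul]
    | 1, _, _ => rw [phi_one, Matrix.one_mul]
    | n + 2, ih, hn =>
      have hu := (Matrix.isUnit_iff_isUnit_det _).1 (isUnit_offDiag ha (n + 1))
      have h1 := h (n + 1) (by omega) (by omega)
      rw [Nat.add_sub_cancel] at h1
      have h2 : offDiag a (n + 1) * U (n + 2) = z • U (n + 1) - diag b (n + 1) * U (n + 1)
          - (offDiag a n)ᴴ * U n := by
        rw [← h1]; abel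
      rw [← Matrix.nonsing_inv_mul_cancel_left _ (U (n + 2)) hu, h2, ih (n + 1) (by omega) (by omega),
        ih n (by omega) (by omega), phi]
      simp only [Matrix.mul_assoc, Matrix.sub_mul, Matrix.smul_mul]

/-- The matrix polynomial `φ_n`, with `z` replaced by an indeterminate. -/
def phiPoly (a : Fin (p - 1) → Matrix (Fin m) (Fin m) ℂ) (b : Fin p → Matrix (Fin m) (Fin m) ℂ) :
    ℕ → Polynomial (Matrix (Fin m) (Fin m) ℂ)
  | 0 => 0
  | 1 => 1
  | n + 2 => Polynomial.C (offDiag a (n + 1))⁻¹ *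
      (phiPoly a b (n + 1) * Polynomial.X - Polynomial.C (diag b (n + 1)) * phiPoly a b (n + 1)
        - Polynomial.C (offDiag a n)ᴴ * phiPoly a b n)

theorem eval_phiPoly (z : ℂ) (n : ℕ) :
    (phiPoly a b n).eval (z • (1 : Matrix (Fin m) (Fin m) ℂ)) = phi a b z n := by
  induction n using Nat.twoStepInduction with
  | zero => simp [phiPoly, phi]
  | one => simp [phiPoly, phi]
  | more n h0 h1 =>
    simp only [phiPoly, phi, Polynomial.eval_C_mul, Polynomial.eval_sub, Polynomial.eval_mul_X,
      h0, h1]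
    simp

theorem coeff_phiPoly_eq_zero (n : ℕ) : ∀ s, n ≤ s → (phiPoly a b n).coeff s = 0 := by
  induction n using Nat.twoStepInduction with
  | zero => simp [phiPoly]
  | one =>
    intro s hs
    rw [phiPoly, Polynomial.coeff_one, if_neg (by omega)]
  | more n h0 h1 =>
    intro s hs
    obtain ⟨s, rfl⟩ := Nat.exists_eq_add_of_le' (show 1 ≤ s by omega)
    simp only [phiPoly, Polynomial.coeff_C_mul, Polynomial.coeff_sub, Polynomial.coeff_mul_X]
    rw [h0 _ (by omega), h1 s (by omega), h1 (s + 1) (by omega)]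
    simp

theorem coeff_phiPoly_succ_self (n : ℕ) :
    (phiPoly a b (n + 2)).coeff (n + 1) =
      (offDiag a (n + 1))⁻¹ * (phiPoly a b (n + 1)).coeff n := by
  simp only [phiPoly, Polynomial.coeff_C_mul, Polynomial.coeff_sub, Polynomial.coeff_mul_X]
  rw [coeff_phiPoly_eq_zero n _ (by omega), coeff_phiPoly_eq_zero (n + 1) _ le_rfl]
  simp

theorem isUnit_coeff_phiPoly (n : ℕ) (ha : ∀ k, k ≤ n → IsUnit (offDiag a k)) :
    IsUnit ((phiPoly a b (n + 1)).coeff n) := by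
  induction n with
  | zero => simp [phiPoly]
  | succ n ih =>
    rw [coeff_phiPoly_succ_self]
    exact ((Matrix.isUnit_nonsing_inv_iff).2 (ha _ le_rfl)).mul
      (ih fun k hk => ha k (by omega))

theorem phi_eq_sum_coeff (z : ℂ) {n M : ℕ} (h : n ≤ M) :
    phi a b z n = ∑ s : Fin M, z ^ (s : ℕ) • (phiPoly a b n).coeff s := by
  rw [← eval_phiPoly]
  have : (phiPoly a b n).degree < (M : WithBot ℕ) := by
    rw [Polynomial.degree_lt_iff_coeff_zero]
    exact fun s hs => coeff_phiPoly_eq_zero n s (h.trans hs)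
  rw [Polynomial.eval_eq_sum, Polynomial.sum_eq_of_subset (s := Finset.range M), Finset.sum_range]
  · refine Finset.sum_congr rfl fun s _ => ?_
    rw [smul_pow, one_pow, mul_smul_comm, mul_one]
  · simp
  · intro s hs
    rw [Finset.mem_range]
    by_contra hlt
    exact Polynomial.mem_support_iff.1 hs (coeff_phiPoly_eq_zero n s (by omega))

end phi

/-! ### Moments and Hankel matrices -/

section Hankel

variable {m p N : ℕ}

/-- The column of the blocks `1, z, …, z^{p-1}` (times the identity). -/
def powCol (m p : ℕ) (z : ℂ) : Matrix (Fin p × Fin m) (Fin m) ℂ :=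
  blockCol p fun n => z ^ (n - 1) • 1

/-- The block Hankel matrix of the moments `∑ⱼ λⱼ^{s+k} Wⱼ`, `0 ≤ s, k < p`. -/
def hankel (p : ℕ) (lam : Fin N → ℝ) (W : Fin N → Matrix (Fin m) (Fin m) ℂ) :
    Matrix (Fin p × Fin m) (Fin p × Fin m) ℂ :=
  Matrix.comp (Fin p) (Fin p) (Fin m) (Fin m) ℂ
    (Matrix.of fun s k : Fin p => moment lam W (s + k))

theorem hankel_eq_sum (lam : Fin N → ℝ) (W : Fin N → Matrix (Fin m) (Fin m) ℂ) :
    hankel p lam W = ∑ j, powCol m p (lam j) * (W j * (powCol m p (lam j))ᴴ) := by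
  ext ⟨s, i⟩ ⟨k, l⟩
  rw [Matrix.sum_apply]
  change (∑ j, ((lam j : ℂ) ^ ((s : ℕ) + k)) • W j) i l = _
  rw [Matrix.sum_apply]
  refine Finset.sum_congr rfl fun j _ => ?_
  change _ = (((lam j : ℂ) ^ ((s : ℕ) + 1 - 1) • (1 : Matrix (Fin m) (Fin m) ℂ)) *
    (W j * ((lam j : ℂ) ^ ((k : ℕ) + 1 - 1) • (1 : Matrix (Fin m) (Fin m) ℂ))ᴴ)) i l
  rw [Matrix.conjTranspose_smul, Matrix.conjTranspose_one, star_pow,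
    show star (lam j : ℂ) = lam j from Complex.conj_ofReal _, Matrix.mul_smul, Matrix.mul_one,
    Matrix.smul_mul, Matrix.one_mul, smul_smul, pow_add]
  rfl

theorem hankel_mulVec_eq_zero_iff (lam : Fin N → ℝ) (W : Fin N → Matrix (Fin m) (Fin m) ℂ)
    (hW : ∀ j, (W j).PosSemidef) (x : Fin p × Fin m → ℂ) :
    hankel p lam W *ᵥ x = 0 ↔ ∀ j, W j *ᵥ ((powCol m p (lam j))ᴴ *ᵥ x) = 0 := by
  constructor
  · intro h
    have h1 : ∑ j, star ((powCol m p (lam j))ᴴ *ᵥ x) ⬝ᵥ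
        (W j *ᵥ ((powCol m p (lam j))ᴴ *ᵥ x)) = 0 := by
      have h2 : star x ⬝ᵥ (hankel p lam W *ᵥ x) = 0 := by rw [h, dotProduct_zero]
      rw [hankel_eq_sum, Matrix.sum_mulVec, dotProduct_sum] at h2
      rw [← h2]
      refine Finset.sum_congr rfl fun j _ => ?_
      rw [← Matrix.mulVec_mulVec, ← Matrix.mulVec_mulVec, Matrix.star_mulVec,
        Matrix.conjTranspose_conjTranspose, ← Matrix.dotProduct_mulVec]
    intro j
    have h3 := (Finset.sum_eq_zero_iff_of_nonneg fun j _ =>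
      (hW j).dotProduct_mulVec_nonneg _).1 h1 j (Finset.mem_univ j)
    exact ((hW j).dotProduct_mulVec_zero_iff _).1 h3
  · intro h
    rw [hankel_eq_sum, Matrix.sum_mulVec]
    refine Finset.sum_eq_zero fun j _ => ?_
    rw [← Matrix.mulVec_mulVec, ← Matrix.mulVec_mulVec, h j, Matrix.mulVec_zero]

theorem det_hankel_ne_zero_iff (lam : Fin N → ℝ) (W : Fin N → Matrix (Fin m) (Fin m) ℂ)
    (hW : ∀ j, (W j).PosSemidef) :
    (hankel p lam W).det ≠ 0 ↔
      ∀ x, (∀ j, W j *ᵥ ((powCol m p (lam j))ᴴ *ᵥ x) = 0) → x = 0 := by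
  rw [Ne, ← Matrix.exists_mulVec_eq_zero_iff]
  push Not
  refine forall_congr' fun x => ?_
  rw [← hankel_mulVec_eq_zero_iff lam W hW]
  tauto

variable {P G W : Fin N → Matrix (Fin m) (Fin m) ℂ}

theorem IsInversePairOn.proj_posSemidef {P G W : Matrix (Fin m) (Fin m) ℂ}
    (h : IsInversePairOn P G W) : P.PosSemidef := by
  have := Matrix.posSemidef_conjTranspose_mul_self P
  rwa [h.proj_herm, h.proj_mul_proj] at this

/-- The moments of the projectors and those of the weights have Hankel matrices with the same
kernel, because `Pⱼ` and `Wⱼ` have the same kernel. -/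
theorem det_hankel_proj_ne_zero_iff (lam : Fin N → ℝ)
    (h : ∀ j, IsInversePairOn (P j) (G j) (W j)) :
    (hankel p lam P).det ≠ 0 ↔ (hankel p lam W).det ≠ 0 := by
  rw [det_hankel_ne_zero_iff _ _ fun j => (h j).weight_posSemidef,
    det_hankel_ne_zero_iff _ _ fun j => (h j).proj_posSemidef]
  have : ∀ j (y : Fin m → ℂ), P j *ᵥ y = 0 ↔ W j *ᵥ y = 0 := by
    intro j y
    constructor
    · intro hy; rw [← (h j).weight_mul_proj, ← Matrix.mulVec_mulVec, hy, Matrix.mulVec_zero]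
    · intro hy; rw [← (h j).gram_mul_weight, ← Matrix.mulVec_mulVec, hy, Matrix.mulVec_zero]
  simp only [this]

/-- The coefficient matrix of `φ_1, …, φ_p` transforms the moment matrix of an orthonormality
measure into the identity. -/
theorem det_hankel_ne_zero_of_orthonormal (a : Fin (p - 1) → Matrix (Fin m) (Fin m) ℂ)
    (b : Fin p → Matrix (Fin m) (Fin m) ℂ) (lam : Fin N → ℝ)
    (W : Fin N → Matrix (Fin m) (Fin m) ℂ)
    (h : ∑ j, blockCol p (phi a b (lam j)) * (W j * (blockCol p (phi a b (lam j)))ᴴ) = 1) :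
    (hankel p lam W).det ≠ 0 := by
  let C : Matrix (Fin p × Fin m) (Fin p × Fin m) ℂ :=
    Matrix.of fun x y => (phiPoly a b (x.1 + 1)).coeff y.1 x.2 y.2
  have hC : ∀ z, blockCol p (phi a b z) = C * powCol m p z := by
    intro z
    ext ⟨n, i⟩ k
    change phi a b z (n + 1) i k = _
    rw [phi_eq_sum_coeff z (show (n : ℕ) + 1 ≤ p by omega), Matrix.sum_apply, Matrix.mul_apply,
      Fintype.sum_prod_type]
    refine Finset.sum_congr rfl fun s _ => ?_
    simp [C, powCol, blockCol, Matrix.one_apply, mul_comm]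
  have h1 : C * hankel p lam W * Cᴴ = 1 := by
    rw [hankel_eq_sum, Finset.mul_sum, Finset.sum_mul, ← h]
    refine Finset.sum_congr rfl fun j _ => ?_
    rw [hC, Matrix.conjTranspose_mul]
    simp only [Matrix.mul_assoc]
  intro h0
  have h2 := congrArg Matrix.det h1
  rw [Matrix.det_mul, Matrix.det_mul, h0] at h2
  simp at h2

end Hankel

/-! ### The matrix-valued form of a measure -/

section pairing

variable {m N : ℕ} (W : Fin N → Matrix (Fin m) (Fin m) ℂ)

/-- The matrix-valued form `∑ⱼ Fⱼ Wⱼ Hⱼ^*` on matrix functions on the set of eigenvalues. -/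
def pairing (F H : Fin N → Matrix (Fin m) (Fin m) ℂ) : Matrix (Fin m) (Fin m) ℂ :=
  ∑ j, F j * W j * (H j)ᴴ

variable {W}

theorem pairing_add_left (F F' H : Fin N → Matrix (Fin m) (Fin m) ℂ) :
    pairing W (fun j => F j + F' j) H = pairing W F H + pairing W F' H := by
  simp only [pairing, Matrix.add_mul, Finset.sum_add_distrib]

theorem pairing_mul_left (A : Matrix (Fin m) (Fin m) ℂ) (F H : Fin N → Matrix (Fin m) (Fin m) ℂ) :
    pairing W (fun j => A * F j) H = A * pairing W F H := by
  simp only [pairing, Matrix.mul_assoc, Finset.mul_sum]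

theorem pairing_zero_left (H : Fin N → Matrix (Fin m) (Fin m) ℂ) :
    pairing W (fun _ => 0) H = 0 := by
  simp [pairing]

theorem conjTranspose_pairing (hW : ∀ j, (W j)ᴴ = W j)
    (F H : Fin N → Matrix (Fin m) (Fin m) ℂ) : (pairing W F H)ᴴ = pairing W H F := by
  simp only [pairing, Matrix.conjTranspose_sum, Matrix.conjTranspose_mul, hW,
    Matrix.conjTranspose_conjTranspose, Matrix.mul_assoc]

theorem pairing_mul_right (hW : ∀ j, (W j)ᴴ = W j) (A : Matrix (Fin m) (Fin m) ℂ)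
    (F H : Fin N → Matrix (Fin m) (Fin m) ℂ) :
    pairing W F (fun j => A * H j) = pairing W F H * Aᴴ := by
  rw [← conjTranspose_pairing hW, pairing_mul_left, Matrix.conjTranspose_mul,
    conjTranspose_pairing hW]

/-- Multiplication by the real function `λ` is symmetric. -/
theorem pairing_smul_left (lam : Fin N → ℝ) (F H : Fin N → Matrix (Fin m) (Fin m) ℂ) :
    pairing W (fun j => (lam j : ℂ) • F j) H = pairing W F (fun j => (lam j : ℂ) • H j) := by
  refine Finset.sum_congr rfl fun j _ => ?_
  rw [Matrix.conjTranspose_smul, show star (lam j : ℂ) = lam j from Complex.conj_ofReal _]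
  simp only [Matrix.smul_mul, Matrix.mul_smul]

end pairing

/-! ### Recursion coefficients and orthonormalization -/

section

variable {m p N : ℕ} {a a' : Fin (p - 1) → Matrix (Fin m) (Fin m) ℂ}
  {b b' : Fin p → Matrix (Fin m) (Fin m) ℂ} {lam : Fin N → ℝ}
  {W : Fin N → Matrix (Fin m) (Fin m) ℂ}

/-- The values of `φ_n` on the set of eigenvalues. -/
def phiAt (a : Fin (p - 1) → Matrix (Fin m) (Fin m) ℂ) (b : Fin p → Matrix (Fin m) (Fin m) ℂ)
    (lam : Fin N → ℝ) (n : ℕ) (j : Fin N) : Matrix (Fin m) (Fin m) ℂ :=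
  phi a b (lam j) n

theorem phi_congr {n : ℕ} (h : ∀ k, 1 ≤ k → k < n → offDiag a k = offDiag a' k ∧
    diag b k = diag b' k) (z : ℂ) : ∀ k, k ≤ n → phi a b z k = phi a' b' z k := by
  intro k
  induction k using Nat.twoStepInduction with
  | zero => simp [phi]
  | one => simp [phi]
  | more k h0 h1 =>
    intro hk
    rw [phi, phi, h0 (by omega), h1 (by omega), (h (k + 1) (by omega) (by omega)).1,
      (h (k + 1) (by omega) (by omega)).2]
    rcases Nat.eq_zero_or_pos k with rfl | hk0
    · rw [offDiag_zero, offDiag_zero]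
    · rw [(h k hk0 (by omega)).1]

theorem pairing_recursion (ha : ∀ n, IsUnit (a n)) {n : ℕ} (hn : 1 ≤ n)
    (H : Fin N → Matrix (Fin m) (Fin m) ℂ) :
    pairing W (fun j => (lam j : ℂ) • phiAt a b lam n j) H =
      offDiag a n * pairing W (phiAt a b lam (n + 1)) H + diag b n * pairing W (phiAt a b lam n) H
        + (offDiag a (n - 1))ᴴ * pairing W (phiAt a b lam (n - 1)) H := by
  rw [← pairing_mul_left, ← pairing_mul_left, ← pairing_mul_left, ← pairing_add_left,
    ← pairing_add_left]
  congr 1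
  funext j
  simp only [phiAt]
  rw [offDiag_mul_phi (isUnit_offDiag ha n) hn]
  abel

theorem pairing_phiAt_zero (H : Fin N → Matrix (Fin m) (Fin m) ℂ) :
    pairing W (phiAt a b lam 0) H = 0 := by
  have : phiAt a b lam 0 = fun _ => 0 := by funext j; simp [phiAt, phi]
  rw [this, pairing_zero_left]

/-- Orthonormality of `φ_1, …, φ_n` with respect to the measure with weights `Wⱼ` at `λⱼ`. -/
def IsOrthonormalUpTo (a : Fin (p - 1) → Matrix (Fin m) (Fin m) ℂ)
    (b : Fin p → Matrix (Fin m) (Fin m) ℂ) (lam : Fin N → ℝ)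
    (W : Fin N → Matrix (Fin m) (Fin m) ℂ) (n : ℕ) : Prop :=
  ∀ k l, 1 ≤ k → k ≤ n → 1 ≤ l → l ≤ n →
    pairing W (phiAt a b lam k) (phiAt a b lam l) = if k = l then 1 else 0

/-- `b_n` is determined by `φ_n`. -/
theorem diag_eq_pairing (ha : ∀ n, IsUnit (a n)) (ho : IsOrthonormalUpTo a b lam W p)
    (hlast : ∀ j, phi a b (lam j) (p + 1) * W j = 0) {n : ℕ} (hn : 1 ≤ n) (hnp : n ≤ p) :
    diag b n = pairing W (fun j => (lam j : ℂ) • phiAt a b lam n j) (phiAt a b lam n) := by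
  have h1 : pairing W (phiAt a b lam (n + 1)) (phiAt a b lam n) = 0 := by
    rcases hnp.lt_or_eq with h | rfl
    · rw [ho _ _ (by omega) (by omega) hn hnp, if_neg (by omega)]
    · refine Finset.sum_eq_zero fun j _ => ?_
      rw [phiAt, hlast, Matrix.zero_mul]
  have h2 : pairing W (phiAt a b lam (n - 1)) (phiAt a b lam n) = 0 := by
    rcases hn.lt_or_eq with h | rfl
    · rw [ho _ _ (by omega) (by omega) hn hnp, if_neg (by omega)]
    · exact pairing_phiAt_zero _
  rw [pairing_recursion ha hn, h1, h2, ho n n hn hnp hn hnp]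
  simp

/-- The measure determines the coefficients: by induction, `b_n` and `a_n a_n^*` are determined by
`φ_1, …, φ_n`, hence so is `φ_{n+1}`. -/
theorem eq_of_isOrthonormalUpTo {C : Matrix (Fin m) (Fin m) ℂ → Prop} (hC : IsFactorClass C)
    (ha : ∀ n, C (a n)) (ha' : ∀ n, C (a' n)) (hW : ∀ j, (W j)ᴴ = W j)
    (ho : IsOrthonormalUpTo a b lam W p) (hlast : ∀ j, phi a b (lam j) (p + 1) * W j = 0)
    (ho' : IsOrthonormalUpTo a' b' lam W p) (hlast' : ∀ j, phi a' b' (lam j) (p + 1) * W j = 0) :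
    a = a' ∧ b = b' := by
  have ua := fun n => hC.isUnit _ (ha n)
  have ua' := fun n => hC.isUnit _ (ha' n)
  have key : ∀ n, 1 ≤ n → n ≤ p → offDiag a n = offDiag a' n ∧ diag b n = diag b' n := by
    intro n
    induction n using Nat.strong_induction_on with
    | _ n ih =>
      intro hn hnp
      have hphi : ∀ k, k ≤ n → phiAt a b lam k = phiAt a' b' lam k := fun k hk => funext fun j =>
        phi_congr (fun k hk hkn => ih k hkn hk (by omega)) _ k hk
      have hb : diag b n = diag b' n := by
        rw [diag_eq_pairing ua ho hlast hn hnp, diag_eq_pairing ua' ho' hlast' hn hnp,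
          hphi n le_rfl]
      refine ⟨?_, hb⟩
      rcases hnp.lt_or_eq with h | rfl
      · have hR : (fun j => offDiag a n * phiAt a b lam (n + 1) j) =
            fun j => offDiag a' n * phiAt a' b' lam (n + 1) j := by
          funext j
          have e0 := congrFun (hphi n le_rfl) j
          have e1 := congrFun (hphi (n - 1) (by omega)) j
          simp only [phiAt] at e0 e1 ⊢
          rw [offDiag_mul_phi (isUnit_offDiag ua n) hn, offDiag_mul_phi (isUnit_offDiag ua' n) hn,
            hb, e0, e1]
          rcases hn.lt_or_eq with h1 | rfl
          · rw [(ih (n - 1) (by omega) (by omega) (by omega)).1]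
          · simp [offDiag_zero]
        have h1 : offDiag a n * (offDiag a n)ᴴ = offDiag a' n * (offDiag a' n)ᴴ := by
          have e := congrArg (fun F => pairing W F F) hR
          simp only [pairing_mul_left, pairing_mul_right hW] at e
          rw [ho _ _ (by omega) (by omega) (by omega) (by omega),
            ho' _ _ (by omega) (by omega) (by omega) (by omega)] at e
          simpa using e
        have hlt : 1 ≤ n ∧ n < p := ⟨hn, h⟩
        simp only [offDiag, dif_pos hlt] at h1 ⊢
        exact hC.unique _ _ (ha _) (ha' _) h1
      · rw [offDiag_self, offDiag_self]
  constructor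
  · funext n
    have h := (key (n + 1) (by omega) (by omega)).1
    have hlt : 1 ≤ (n : ℕ) + 1 ∧ (n : ℕ) + 1 < p := by omega
    simp only [offDiag, dif_pos hlt] at h
    exact h
  · funext n
    have h := (key (n + 1) (by omega) (by omega)).2
    have hlt : 1 ≤ (n : ℕ) + 1 ∧ (n : ℕ) + 1 ≤ p := by omega
    simp only [diag, dif_pos hlt] at h
    exact h

/-- The next function produced by the recursion is orthogonal to the preceding ones. -/
theorem pairing_succ_eq_zero (ha : ∀ n, IsUnit (a n)) (hW : ∀ j, (W j)ᴴ = W j) {n : ℕ}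
    (hn : 1 ≤ n) (ho : IsOrthonormalUpTo a b lam W n)
    (hd : diag b n = pairing W (fun j => (lam j : ℂ) • phiAt a b lam n j) (phiAt a b lam n))
    {k : ℕ} (hk : 1 ≤ k) (hkn : k ≤ n) :
    pairing W (phiAt a b lam (n + 1)) (phiAt a b lam k) = 0 := by
  suffices h : offDiag a n * pairing W (phiAt a b lam (n + 1)) (phiAt a b lam k) = 0 by
    have hu := (Matrix.isUnit_iff_isUnit_det _).1 (isUnit_offDiag ha n)
    rw [← Matrix.nonsing_inv_mul_cancel_left _ (pairing W _ _) hu, h, Matrix.mul_zero]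
  have hrec := pairing_recursion (b := b) (lam := lam) (W := W) ha hn (phiAt a b lam k)
  have h1 : pairing W (fun j => (lam j : ℂ) • phiAt a b lam n j) (phiAt a b lam k) =
      diag b n * pairing W (phiAt a b lam n) (phiAt a b lam k)
        + (offDiag a (n - 1))ᴴ * pairing W (phiAt a b lam (n - 1)) (phiAt a b lam k) := by
    rcases hkn.lt_or_eq with hlt | rfl
    · have hprev : pairing W (phiAt a b lam (k - 1)) (phiAt a b lam n) = 0 := by
        rcases hk.lt_or_eq with h1 | rfl
        · rw [ho _ _ (by omega) (by omega) hn le_rfl, if_neg (by omega)]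
        · exact pairing_phiAt_zero _
      rw [pairing_smul_left, ← conjTranspose_pairing hW, pairing_recursion ha hk, hprev,
        ho _ _ (by omega) (by omega) hn le_rfl, ho k n hk (by omega) hn le_rfl, if_neg hlt.ne,
        ho _ _ hn le_rfl hk (by omega), if_neg hlt.ne',
        ho (n - 1) k (by omega) (by omega) hk (by omega)]
      by_cases h2 : k + 1 = n
      · subst h2; simp
      · rw [if_neg h2, if_neg (by omega)]; simp
    · have hprev : pairing W (phiAt a b lam (k - 1)) (phiAt a b lam k) = 0 := by
        rcases hk.lt_or_eq with h1 | rfl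
        · rw [ho _ _ (by omega) (by omega) hn le_rfl, if_neg (by omega)]
        · exact pairing_phiAt_zero _
      rw [← hd, hprev, ho _ _ hk le_rfl hk le_rfl]
      simp
  rw [h1, add_assoc] at hrec
  exact right_eq_add.1 hrec

/-- Nondegeneracy of the moments makes the Gram matrix of `φ_{n+1}`, a polynomial of degree
`n < p` with invertible leading coefficient, positive definite. -/
theorem posDef_pairing_phiAt (ha : ∀ n, IsUnit (a n)) (hW : ∀ j, (W j).PosSemidef)
    (hH : (hankel p lam W).det ≠ 0) {n : ℕ} (hn : n < p) :
    (pairing W (phiAt a b lam (n + 1)) (phiAt a b lam (n + 1))).PosDef := by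
  have hps : ∀ j, (phiAt a b lam (n + 1) j * W j * (phiAt a b lam (n + 1) j)ᴴ).PosSemidef :=
    fun j => (hW j).mul_mul_conjTranspose_same _
  have hS : (pairing W (phiAt a b lam (n + 1)) (phiAt a b lam (n + 1))).PosSemidef :=
    Matrix.posSemidef_sum _ fun j _ => hps j
  rw [hS.posDef_iff_det_ne_zero, Ne, ← Matrix.exists_mulVec_eq_zero_iff]
  rintro ⟨v, hv0, hv⟩
  apply hv0
  have hWv : ∀ j, W j *ᵥ ((phiAt a b lam (n + 1) j)ᴴ *ᵥ v) = 0 := by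
    have h1 : ∑ j, star v ⬝ᵥ ((phiAt a b lam (n + 1) j * W j * (phiAt a b lam (n + 1) j)ᴴ) *ᵥ v)
        = 0 := by
      rw [← dotProduct_sum, ← Matrix.sum_mulVec]
      change star v ⬝ᵥ (pairing W _ _ *ᵥ v) = 0
      rw [hv, dotProduct_zero]
    intro j
    have h2 := (Finset.sum_eq_zero_iff_of_nonneg fun j _ =>
      (hps j).dotProduct_mulVec_nonneg v).1 h1 j (Finset.mem_univ j)
    rw [← (hW j).dotProduct_mulVec_zero_iff, Matrix.star_mulVec, Matrix.conjTranspose_conjTranspose,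
      ← Matrix.dotProduct_mulVec, Matrix.mulVec_mulVec, Matrix.mulVec_mulVec, Matrix.mul_assoc, ← Matrix.mul_assoc]
    exact h2
  let x : Fin p × Fin m → ℂ := fun s => (((phiPoly a b (n + 1)).coeff s.1)ᴴ *ᵥ v) s.2
  have hx : ∀ j, (phiAt a b lam (n + 1) j)ᴴ *ᵥ v = (powCol m p (lam j))ᴴ *ᵥ x := by
    intro j
    rw [phiAt, phi_eq_sum_coeff _ (show n + 1 ≤ p by omega), Matrix.conjTranspose_sum,
      Matrix.sum_mulVec]
    funext i
    rw [Finset.sum_apply]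
    conv_rhs => rw [Matrix.mulVec, dotProduct, Fintype.sum_prod_type]
    refine Finset.sum_congr rfl fun s _ => ?_
    simp [powCol, blockCol, Matrix.conjTranspose_smul, Matrix.smul_mulVec, Matrix.one_apply, x,
      apply_ite (starRingEnd ℂ)]
  have hx0 : x = 0 := (det_hankel_ne_zero_iff lam W hW).1 hH x fun j => by rw [← hx, hWv]
  have hcv : ((phiPoly a b (n + 1)).coeff n)ᴴ *ᵥ v = 0 := by
    funext i
    exact congrFun hx0 (⟨n, hn⟩, i)
  have hu : IsUnit ((phiPoly a b (n + 1)).coeff n)ᴴ :=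
    (isUnit_coeff_phiPoly n fun k _ => isUnit_offDiag ha k).star
  exact (Matrix.mulVec_injective_iff_isUnit.2 hu) (by rw [hcv, Matrix.mulVec_zero])

theorem offDiag_update (A : Matrix (Fin m) (Fin m) ℂ) {n : ℕ} (hn : 1 ≤ n) (hnp : n < p) (k : ℕ) :
    offDiag (Function.update a ⟨n - 1, by omega⟩ A) k = if k = n then A else offDiag a k := by
  unfold offDiag
  by_cases hk : 1 ≤ k ∧ k < p
  · rw [dif_pos hk, dif_pos hk, Function.update_apply]
    congr 1
    rw [Fin.mk.injEq, eq_iff_iff]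
    omega
  · rw [dif_neg hk, dif_neg hk, if_neg (by omega)]

theorem diag_update (B : Matrix (Fin m) (Fin m) ℂ) {n : ℕ} (hn : 1 ≤ n) (hnp : n ≤ p) (k : ℕ) :
    diag (Function.update b ⟨n - 1, by omega⟩ B) k = if k = n then B else diag b k := by
  unfold diag
  by_cases hk : 1 ≤ k ∧ k ≤ p
  · rw [dif_pos hk, dif_pos hk, Function.update_apply]
    congr 1
    rw [Fin.mk.injEq, eq_iff_iff]
    omega
  · rw [dif_neg hk, dif_neg hk, if_neg (by omega)]

/-- Orthonormalization: a nondegenerate measure with total mass `I` admits recursion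
coefficients, with `a_n` in a prescribed factor class, for which `φ_1, …, φ_n` are orthonormal. -/
theorem exists_isOrthonormalUpTo {C : Matrix (Fin m) (Fin m) ℂ → Prop} (hC : IsFactorClass C)
    (hp : 1 ≤ p) (hW : ∀ j, (W j).PosSemidef) (hsum : ∑ j, W j = 1)
    (hH : (hankel p lam W).det ≠ 0) :
    ∀ n, 1 ≤ n → n ≤ p → ∃ (a : Fin (p - 1) → Matrix (Fin m) (Fin m) ℂ)
      (b : Fin p → Matrix (Fin m) (Fin m) ℂ), (∀ k, C (a k)) ∧ (∀ k, (b k).IsHermitian) ∧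
      IsOrthonormalUpTo a b lam W n ∧
      diag b n = pairing W (fun j => (lam j : ℂ) • phiAt a b lam n j) (phiAt a b lam n) := by
  have hWH : ∀ j, (W j)ᴴ = W j := fun j => (hW j).isHermitian.eq
  have hherm : ∀ F : Fin N → Matrix (Fin m) (Fin m) ℂ,
      (pairing W (fun j => (lam j : ℂ) • F j) F).IsHermitian := by
    intro F
    rw [Matrix.IsHermitian, conjTranspose_pairing hWH, ← pairing_smul_left]
  intro n hn
  induction n, hn using Nat.le_induction with
  | base =>
    intro _
    obtain ⟨A, hA, -⟩ := hC.exist 1 Matrix.PosDef.one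
    refine ⟨fun _ => A, fun _ => pairing W (fun j => (lam j : ℂ) • 1) (fun _ => 1), fun _ => hA,
      fun _ => hherm _, ?_, ?_⟩
    · intro k l hk hk' hl hl'
      obtain rfl : k = 1 := by omega
      obtain rfl : l = 1 := by omega
      simp [pairing, phiAt, phi_one, hsum]
    · simp only [phiAt, phi_one]
      rw [diag, dif_pos ⟨le_rfl, hp⟩]
      rfl
  | succ n hn ih =>
    intro hnp
    obtain ⟨a, b, haC, hb, ho, hd⟩ := ih (by omega)
    have ha := fun k => hC.isUnit _ (haC k)
    -- the Gram matrix of the unnormalized next function `offDiag a n * φ_{n+1}`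
    have hS : (offDiag a n * pairing W (phiAt a b lam (n + 1)) (phiAt a b lam (n + 1)) *
        (offDiag a n)ᴴ).PosDef :=
      (Matrix.IsUnit.posDef_star_right_conjugate_iff (isUnit_offDiag ha n)).2
        (posDef_pairing_phiAt ha hW hH (by omega))
    obtain ⟨A, hA, hAS⟩ := hC.exist _ hS
    set a' := Function.update a ⟨n - 1, by omega⟩ A with ha'
    set β := pairing W (fun j => (lam j : ℂ) • phiAt a' b lam (n + 1) j)
      (phiAt a' b lam (n + 1)) with hβ
    set b' := Function.update b ⟨n + 1 - 1, by omega⟩ β with hb'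
    have haC' : ∀ k, C (a' k) := by
      intro k
      rw [ha', Function.update_apply]
      split_ifs
      · exact hA
      · exact haC k
    have hau' := fun k => hC.isUnit _ (haC' k)
    have hoff : ∀ k, offDiag a' k = if k = n then A else offDiag a k :=
      offDiag_update A hn (by omega)
    have hdiag : ∀ k, diag b' k = if k = n + 1 then β else diag b k :=
      diag_update β (by omega) hnp
    -- changing `b_{n+1}` does not affect `φ_1, …, φ_{n+1}`
    have hphib : ∀ k, k ≤ n + 1 → phiAt a' b' lam k = phiAt a' b lam k := fun k hk =>
      funext fun j => phi_congr (n := n + 1)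
        (fun l _ hl => ⟨rfl, by rw [hdiag, if_neg (by omega)]⟩) _ k hk
    have hphia : ∀ k, k ≤ n → phiAt a' b lam k = phiAt a b lam k := fun k hk =>
      funext fun j => phi_congr (n := n)
        (fun l _ hl => ⟨by rw [hoff, if_neg (by omega)], rfl⟩) _ k hk
    have hAu : IsUnit A := hC.isUnit _ hA
    have hAd : IsUnit A.det := (Matrix.isUnit_iff_isUnit_det _).1 hAu
    have hnext : ∀ j, A * phiAt a' b lam (n + 1) j = offDiag a n * phiAt a b lam (n + 1) j := by
      intro j
      have h1 := offDiag_mul_phi (b := b) (isUnit_offDiag hau' n) hn (lam j : ℂ)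
      have h2 := offDiag_mul_phi (b := b) (isUnit_offDiag ha n) hn (lam j : ℂ)
      have e0 := congrFun (hphia n le_rfl) j
      have e1 := congrFun (hphia (n - 1) (by omega)) j
      simp only [phiAt] at e0 e1 ⊢
      rw [hoff, if_pos rfl, hoff (n - 1), if_neg (by omega)] at h1
      rw [h1, h2, e0, e1]
    have hortho : ∀ k, 1 ≤ k → k ≤ n →
        pairing W (phiAt a' b lam (n + 1)) (phiAt a' b lam k) = 0 := by
      intro k hk hkn
      have h1 : A * pairing W (phiAt a' b lam (n + 1)) (phiAt a b lam k) = 0 := by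
        rw [← pairing_mul_left, funext hnext, pairing_mul_left,
          pairing_succ_eq_zero ha hWH hn ho hd hk hkn, Matrix.mul_zero]
      rw [hphia k hkn, ← Matrix.nonsing_inv_mul_cancel_left _ (pairing W _ _) hAd, h1,
        Matrix.mul_zero]
    have hnorm : pairing W (phiAt a' b lam (n + 1)) (phiAt a' b lam (n + 1)) = 1 := by
      have h1 : A * pairing W (phiAt a' b lam (n + 1)) (phiAt a' b lam (n + 1)) * Aᴴ =
          A * 1 * Aᴴ := by
        rw [← pairing_mul_left, ← pairing_mul_right hWH, funext hnext, pairing_mul_left,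
          pairing_mul_right hWH, Matrix.mul_one, hAS, Matrix.mul_assoc]
      have hAHu : IsUnit Aᴴ := hAu.star
      exact hAu.mul_left_cancel (hAHu.mul_right_cancel h1)
    refine ⟨a', b', haC', ?_, ?_, ?_⟩
    · intro k
      rw [hb', Function.update_apply]
      split_ifs
      · exact hherm _
      · exact hb k
    · intro k l hk hk' hl hl'
      rw [hphib k hk', hphib l hl']
      rcases hk'.lt_or_eq with h1 | rfl
      · rcases hl'.lt_or_eq with h2 | rfl
        · rw [hphia k (by omega), hphia l (by omega)]
          exact ho k l hk (by omega) hl (by omega)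
        · rw [← conjTranspose_pairing hWH, hortho k hk (by omega), if_neg (by omega),
            Matrix.conjTranspose_zero]
      · rcases hl'.lt_or_eq with h2 | rfl
        · rw [hortho l hl (by omega), if_neg (by omega)]
        · rw [hnorm, if_pos rfl]
    · rw [hphib _ le_rfl, hdiag, if_pos rfl]

end

/-! ### Projectors onto kernels -/

section kerProj

variable {m : ℕ}

theorem isStarProjection_kerProj (A : Matrix (Fin m) (Fin m) ℂ) : IsStarProjection (kerProj A) := by
  have h := isStarProjection_starProjection (U := LinearMap.ker (Matrix.toEuclideanLin A))
  refine ⟨?_, ?_⟩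
  · rw [IsIdempotentElem, kerProj, ← map_mul, h.isIdempotentElem.eq]
  · have hs := (Matrix.toEuclideanCLM (n := Fin m) (𝕜 := ℂ)).symm.map_star'
      (LinearMap.ker (Matrix.toEuclideanLin A)).starProjection
    rw [h.isSelfAdjoint.star_eq] at hs
    exact hs.symm

theorem toEuclideanLin_kerProj (A : Matrix (Fin m) (Fin m) ℂ) (x : EuclideanSpace ℂ (Fin m)) :
    Matrix.toEuclideanLin (kerProj A) x =
      (LinearMap.ker (Matrix.toEuclideanLin A)).starProjection x := by
  have h : Matrix.toEuclideanCLM (n := Fin m) (𝕜 := ℂ) (kerProj A) =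
      (LinearMap.ker (Matrix.toEuclideanLin A)).starProjection := by
    rw [kerProj, StarAlgEquiv.apply_symm_apply]
  rw [← h]; rfl

theorem mul_kerProj (A : Matrix (Fin m) (Fin m) ℂ) : A * kerProj A = 0 := by
  refine ext_toEuclideanLin fun x => ?_
  rw [toEuclideanLin_mul_apply, toEuclideanLin_kerProj, map_zero, LinearMap.zero_apply]
  exact Submodule.starProjection_apply_mem (LinearMap.ker (Matrix.toEuclideanLin A)) x

theorem kerProj_mulVec {A : Matrix (Fin m) (Fin m) ℂ} {v : Fin m → ℂ} (h : A *ᵥ v = 0) :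
    kerProj A *ᵥ v = v := by
  have h1 : WithLp.toLp 2 v ∈ LinearMap.ker (Matrix.toEuclideanLin A) := by
    rw [LinearMap.mem_ker, Matrix.toLpLin_toLp, Matrix.toLin'_apply, h]; rfl
  have h2 := toEuclideanLin_kerProj A (WithLp.toLp 2 v)
  rw [Submodule.starProjection_eq_self_iff.2 h1, Matrix.toLpLin_toLp] at h2
  exact congrArg WithLp.ofLp h2

theorem kerProj_eq_of_mul_eq_zero {A P : Matrix (Fin m) (Fin m) ℂ} (hPH : Pᴴ = P)
    (h0 : A * P = 0) (h1 : ∀ v, A *ᵥ v = 0 → P *ᵥ v = v) : kerProj A = P := by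
  have hK : (kerProj A)ᴴ = kerProj A := (isStarProjection_kerProj A).isSelfAdjoint
  have e1 : P * kerProj A = kerProj A := by
    apply Matrix.ext_of_mulVec_single
    intro k
    rw [← Matrix.mulVec_mulVec]
    exact h1 _ (by rw [Matrix.mulVec_mulVec, mul_kerProj, Matrix.zero_mulVec])
  have e2 : kerProj A * P = P := by
    apply Matrix.ext_of_mulVec_single
    intro k
    rw [← Matrix.mulVec_mulVec]
    exact kerProj_mulVec (by rw [Matrix.mulVec_mulVec, h0, Matrix.zero_mulVec])
  have e3 := congrArg Matrix.conjTranspose e2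
  rw [Matrix.conjTranspose_mul, hPH, hK, e1] at e3
  exact e3

theorem rank_eq_trace_of_isIdempotent {P : Matrix (Fin m) (Fin m) ℂ} (hP : P * P = P) :
    (P.rank : ℂ) = P.trace := by
  have h : IsIdempotentElem (Matrix.toLin' P) := by
    rw [IsIdempotentElem, Module.End.mul_eq_comp, ← Matrix.toLin'_mul, hP]
  rw [← Matrix.trace_toLin'_eq, (LinearMap.IsIdempotentElem.isProj_range _ h).trace]
  rfl

end kerProj

/-! ### Spectral resolution of the Jacobi operator -/

section eigenvectors

variable {m p N : ℕ} {κ : Type*} {a : Fin (p - 1) → Matrix (Fin m) (Fin m) ℂ}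
  {b : Fin p → Matrix (Fin m) (Fin m) ℂ}

theorem jacobi_mul_phi_mul (ha : ∀ n, IsUnit (a n)) (z : ℂ) (B : Matrix (Fin m) κ ℂ)
    (hB : phi a b z (p + 1) * B = 0) :
    jacobi a b * (blockCol p (phi a b z) * B) = z • (blockCol p (phi a b z) * B) := by
  rw [blockCol_mul, jacobi_mul_blockCol a b _ (by rw [phi_zero, Matrix.zero_mul]) hB]
  change _ = blockCol p (fun n => z • (phi a b z n * B))
  refine blockCol_congr fun n hn _ => ?_
  rw [← Matrix.mul_assoc, ← Matrix.mul_assoc, ← Matrix.mul_assoc,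
    offDiag_mul_phi (isUnit_offDiag ha n) hn, ← Matrix.add_mul, ← Matrix.add_mul,
    ← Matrix.smul_mul]
  congr 1
  abel

theorem jacobi_mulVec_phi_mulVec (ha : ∀ n, IsUnit (a n)) (z : ℂ) {v : Fin m → ℂ}
    (hv : phi a b z (p + 1) *ᵥ v = 0) :
    jacobi a b *ᵥ (blockCol p (phi a b z) *ᵥ v) = z • (blockCol p (phi a b z) *ᵥ v) := by
  have h := jacobi_mul_phi_mul ha z (Matrix.replicateCol Unit v) (b := b) (by
    rw [← Matrix.replicateCol_mulVec, hv]; rfl)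
  rw [← Matrix.replicateCol_mulVec, ← Matrix.replicateCol_mulVec, ← Matrix.replicateCol_smul] at h
  exact Matrix.replicateCol_injective h

/-- Every eigenvector of the Jacobi operator comes from the kernel of `φ_{p+1}`. -/
theorem exists_eq_phi_mulVec (ha : ∀ n, IsUnit (a n)) {z : ℂ} {u : Fin p × Fin m → ℂ}
    (hu : jacobi a b *ᵥ u = z • u) :
    ∃ v, phi a b z (p + 1) *ᵥ v = 0 ∧ u = blockCol p (phi a b z) *ᵥ v := by
  let U : ℕ → Matrix (Fin m) Unit ℂ := fun n =>
    if h : 1 ≤ n ∧ n ≤ p then Matrix.of fun i _ => u (⟨n - 1, by omega⟩, i) else 0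
  have hU0 : U 0 = 0 := by simp [U]
  have hUp : U (p + 1) = 0 := by simp [U]
  have hUu : blockCol p U = Matrix.replicateCol Unit u := by
    ext ⟨n, i⟩ k
    simp [blockCol, U]
  have hrec := jacobi_mul_blockCol a b U hU0 hUp
  rw [hUu, ← Matrix.replicateCol_mulVec, hu, Matrix.replicateCol_smul, ← hUu] at hrec
  have hsol := eq_phi_mul_of_recursion (b := b) ha z U hU0 fun n hn hnp => by
    ext i k
    have h := congrFun (congrFun hrec (⟨n - 1, by omega⟩, i)) k
    simp only [blockCol, Matrix.smul_apply, Matrix.of_apply, Nat.sub_add_cancel hn] at h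
    exact h.symm
  refine ⟨fun i => U 1 i (), ?_, ?_⟩
  · have h := hsol (p + 1) le_rfl
    rw [hUp] at h
    funext i
    exact (congrFun (congrFun h i) ()).symm
  · funext ⟨n, i⟩
    have h := congrFun (congrFun (hsol (n + 1) (by omega)) i) ()
    have h' := congrFun (congrFun hUu (n, i)) ()
    exact h'.symm.trans h

theorem mem_eigenvalueSet_iff {x : ℝ} :
    x ∈ eigenvalueSet a b ↔ ∃ u, u ≠ 0 ∧ jacobi a b *ᵥ u = (x : ℂ) • u := by
  constructor
  · intro h
    obtain ⟨u, hu⟩ := Module.End.HasEigenvalue.exists_hasEigenvector h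
    exact ⟨u, hu.2, by simpa using hu.apply_eq_smul⟩
  · rintro ⟨u, hu, h⟩
    exact Module.End.hasEigenvalue_of_hasEigenvector (x := u)
      ⟨Module.End.mem_eigenspace_iff.2 (by simpa using h), hu⟩

/-- The first block of `(φ_n v)_n` is `v`. -/
theorem blockCol_phi_mulVec_first (hp : 1 ≤ p) (z : ℂ) (v : Fin m → ℂ) (i : Fin m) :
    (blockCol p (phi a b z) *ᵥ v) (⟨0, hp⟩, i) = v i := by
  change (phi a b z (0 + 1) *ᵥ v) i = v i
  rw [zero_add, phi_one, Matrix.one_mulVec]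

theorem blockCol_phi_mulVec_eq_zero (hp : 1 ≤ p) {z : ℂ} {v : Fin m → ℂ}
    (h : blockCol p (phi a b z) *ᵥ v = 0) : v = 0 := by
  funext i
  rw [← blockCol_phi_mulVec_first (a := a) (b := b) hp z v i, h]; rfl

theorem ext_of_forall_isHermitian_eigenvector {n : Type*} [Fintype n] [DecidableEq n]
    {A : Matrix n n ℂ} (hA : A.IsHermitian) {Q : Matrix n n ℂ}
    (h : ∀ (x : ℝ) (u : n → ℂ), A *ᵥ u = (x : ℂ) • u → Q *ᵥ u = u) : Q = 1 := by
  apply Matrix.toEuclideanLin.injective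
  refine hA.eigenvectorBasis.toBasis.ext fun j => ?_
  have h1 := h (hA.eigenvalues j) _ (hA.mulVec_eigenvectorBasis j)
  rw [Matrix.toLpLin_one, OrthonormalBasis.coe_toBasis, Matrix.toLpLin_apply, h1]
  rfl

/-- The data attached to a pair `(a, b)` or reconstructed from spectral data: the nodes `λⱼ`, the
projectors `Pⱼ` onto `Ker φ_{p+1}(λⱼ)`, and weights `Wⱼ` for which `φ_1, …, φ_p` form a complete
orthonormal system, in the form of a resolution of the identity. -/
structure IsSpectralResolution (a : Fin (p - 1) → Matrix (Fin m) (Fin m) ℂ)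
    (b : Fin p → Matrix (Fin m) (Fin m) ℂ) (lam : Fin N → ℝ)
    (P G W : Fin N → Matrix (Fin m) (Fin m) ℂ) : Prop where
  pair : ∀ j, IsInversePairOn (P j) (G j) (W j)
  phi_mul_proj : ∀ j, phi a b (lam j) (p + 1) * P j = 0
  sum_eq_one : ∑ j, blockCol p (phi a b (lam j)) * (W j * (blockCol p (phi a b (lam j)))ᴴ) = 1

variable {lam : Fin N → ℝ} {P G W : Fin N → Matrix (Fin m) (Fin m) ℂ}

theorem IsSpectralResolution.isOrthonormalUpTo (h : IsSpectralResolution a b lam P G W) :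
    IsOrthonormalUpTo a b lam W p := by
  intro k l hk hk' hl hl'
  exact (sum_blockCol_mul_eq_one_iff _ _ _).1 h.sum_eq_one k l hk hk' hl hl'

theorem IsSpectralResolution.phi_mul_weight (h : IsSpectralResolution a b lam P G W) (j : Fin N) :
    phi a b (lam j) (p + 1) * W j = 0 := by
  rw [← (h.pair j).proj_mul_weight, ← Matrix.mul_assoc, h.phi_mul_proj, Matrix.zero_mul]

theorem IsSpectralResolution.sum_weight (hp : 1 ≤ p) (h : IsSpectralResolution a b lam P G W) :
    ∑ j, W j = 1 := by
  have := h.isOrthonormalUpTo 1 1 le_rfl hp le_rfl hp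
  simpa [pairing, phiAt, phi_one] using this

/-- Comparing traces in the resolution of the identity. -/
theorem IsSpectralResolution.sum_rank (h : IsSpectralResolution a b lam P G W)
    (hG : ∀ j, G j = P j * ((blockCol p (phi a b (lam j)))ᴴ * blockCol p (phi a b (lam j))) * P j) :
    ∑ j, (P j).rank = m * p := by
  have h1 := congrArg Matrix.trace h.sum_eq_one
  rw [Matrix.trace_sum, Matrix.trace_one, Fintype.card_prod, Fintype.card_fin,
    Fintype.card_fin] at h1
  have h2 : (∑ j, (P j).rank : ℂ) = (p * m : ℕ) := by
    rw [← h1]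
    refine Finset.sum_congr rfl fun j _ => ?_
    rw [rank_eq_trace_of_isIdempotent (h.pair j).proj_mul_proj]
    set Φ := blockCol p (phi a b (lam j)) with hΦ
    calc (P j).trace = (W j * (P j * (Φᴴ * Φ) * P j)).trace := by
          rw [← hG, (h.pair j).weight_mul_gram]
      _ = ((W j * P j) * (Φᴴ * Φ) * P j).trace := by simp only [Matrix.mul_assoc]
      _ = (W j * (Φᴴ * Φ) * P j).trace := by rw [(h.pair j).weight_mul_proj]
      _ = (P j * W j * (Φᴴ * Φ)).trace := by rw [Matrix.trace_mul_comm, ← Matrix.mul_assoc]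
      _ = (W j * Φᴴ * Φ).trace := by rw [(h.pair j).proj_mul_weight, Matrix.mul_assoc]
      _ = _ := Matrix.trace_mul_comm _ _
  have h3 : ∑ j, (P j).rank = p * m := by exact_mod_cast h2
  rw [h3, mul_comm]

/-- Spectral theorem for the Jacobi operator: the projector onto the eigenspace of `λⱼ` is
`Φⱼ Wⱼ Φⱼ^*`, where `Φⱼ` is the column of `φ_1(λⱼ), …, φ_p(λⱼ)`. -/
theorem isSpectralResolution_of_gram (ha : ∀ n, IsUnit (a n)) (hb : ∀ n, (b n).IsHermitian)
    (hinj : Function.Injective lam)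
    (hspec : ∀ x, x ∈ eigenvalueSet a b → ∃ j, lam j = x)
    (hP : ∀ j, P j = kerProj (phi a b (lam j) (p + 1)))
    (hpair : ∀ j, IsInversePairOn (P j) (G j) (W j))
    (hG : ∀ j, G j = P j * ((blockCol p (phi a b (lam j)))ᴴ * blockCol p (phi a b (lam j))) * P j) :
    IsSpectralResolution a b lam P G W := by
  have hJ := isHermitian_jacobi a b hb
  have hker : ∀ j, phi a b (lam j) (p + 1) * P j = 0 := fun j => by rw [hP, mul_kerProj]
  refine ⟨hpair, hker, ?_⟩
  set Φ := fun j => blockCol p (phi a b (lam j)) with hΦ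
  have hortho : ∀ i j, i ≠ j → (Φ i * P i)ᴴ * (Φ j * P j) = 0 := by
    intro i j hij
    have e1 : jacobi a b * (Φ i * P i) = (lam i : ℂ) • (Φ i * P i) :=
      jacobi_mul_phi_mul (b := b) ha (lam i) _ (hker i)
    have e2 : jacobi a b * (Φ j * P j) = (lam j : ℂ) • (Φ j * P j) :=
      jacobi_mul_phi_mul (b := b) ha (lam j) _ (hker j)
    have e3 : (lam i : ℂ) • ((Φ i * P i)ᴴ * (Φ j * P j)) =
        (lam j : ℂ) • ((Φ i * P i)ᴴ * (Φ j * P j)) := by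
      conv_rhs => rw [← Matrix.mul_smul, ← e2, ← Matrix.mul_assoc]
      have e4 := congrArg Matrix.conjTranspose e1
      rw [Matrix.conjTranspose_mul, hJ.eq, Matrix.conjTranspose_smul,
        show star (lam i : ℂ) = lam i from Complex.conj_ofReal _] at e4
      rw [e4, Matrix.smul_mul]
    rw [← sub_eq_zero, ← sub_smul, smul_eq_zero] at e3
    rcases e3 with h | h
    · exact absurd (hinj (Complex.ofReal_injective (sub_eq_zero.1 h))) hij
    · exact h
  refine ext_of_forall_isHermitian_eigenvector hJ fun x u hu => ?_
  by_cases hu0 : u = 0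
  · rw [hu0, Matrix.mulVec_zero]
  obtain ⟨i, rfl⟩ := hspec x (mem_eigenvalueSet_iff.2 ⟨u, hu0, hu⟩)
  obtain ⟨v, hv, huv⟩ := exists_eq_phi_mulVec ha hu
  have hPv : P i *ᵥ v = v := by rw [hP]; exact kerProj_mulVec hv
  have hcomp : ∀ j, Φ j * (W j * (Φ j)ᴴ) * (Φ i * P i) = if j = i then Φ i * P i else 0 := by
    intro j
    have e1 : Φ j * (W j * (Φ j)ᴴ) * (Φ i * P i) =
        Φ j * (W j * ((Φ j * P j)ᴴ * (Φ i * P i))) := by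
      rw [Matrix.conjTranspose_mul, (hpair j).proj_herm]
      conv_lhs => rw [← (hpair j).weight_mul_proj]
      simp only [Matrix.mul_assoc]
    rw [e1]
    by_cases hij : j = i
    · subst hij
      have e2 : (Φ j * P j)ᴴ * (Φ j * P j) = G j := by
        rw [hG, Matrix.conjTranspose_mul, (hpair j).proj_herm]
        simp only [Matrix.mul_assoc, hΦ]
      rw [e2, (hpair j).weight_mul_gram, if_pos rfl]
    · rw [hortho j i hij, if_neg hij]
      simp
  have hu' : u = (Φ i * P i) *ᵥ v := by rw [← Matrix.mulVec_mulVec, hPv]; exact huv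
  rw [hu', Matrix.mulVec_mulVec, Matrix.sum_mul, Finset.sum_congr rfl fun j _ => hcomp j]
  simp

/-- The dual orthogonality relations. -/
theorem weight_mul_conjTranspose_mul (hr : ∑ j, (P j).rank = m * p)
    (hpair : ∀ j, IsInversePairOn (P j) (G j) (W j))
    (hsum : ∑ j, blockCol p (phi a b (lam j)) * (W j * (blockCol p (phi a b (lam j)))ᴴ) = 1)
    (i j : Fin N) :
    W i * (blockCol p (phi a b (lam i)))ᴴ * blockCol p (phi a b (lam j)) * P j =
      if i = j then P j else 0 :=
  mul_mul_eq_ite_of_sum_mul_eq_one (fun j => blockCol p (phi a b (lam j)))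
    (fun j => W j * (blockCol p (phi a b (lam j)))ᴴ) P
    (fun j => by rw [← Matrix.mul_assoc, (hpair j).proj_mul_weight]) hsum
    (by rw [hr, Fintype.card_prod, Fintype.card_fin, Fintype.card_fin, mul_comm]) i j

/-- Since the `φ_1, …, φ_p` span all functions, `φ_{p+1}`, being orthogonal to them, vanishes on
the support of the measure. -/
theorem isSpectralResolution_of_orthonormal (hp : 1 ≤ p) (ha : ∀ n, IsUnit (a n))
    (hr : ∑ j, (P j).rank = m * p) (hpair : ∀ j, IsInversePairOn (P j) (G j) (W j))
    (ho : IsOrthonormalUpTo a b lam W p)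
    (hd : diag b p = pairing W (fun j => (lam j : ℂ) • phiAt a b lam p j) (phiAt a b lam p)) :
    IsSpectralResolution a b lam P G W := by
  have hsum := (sum_blockCol_mul_eq_one_iff (fun j => phi a b (lam j))
    (fun j => phi a b (lam j)) W).2 ho
  refine ⟨hpair, fun i => ?_, hsum⟩
  have h1 : ∑ j, phi a b (lam j) (p + 1) * (W j * (blockCol p (phi a b (lam j)))ᴴ) = 0 := by
    ext r ⟨n, s⟩
    have h2 := congrFun (congrFun (pairing_succ_eq_zero ha (fun j => (hpair j).weight_herm) hp ho hd
      (k := n + 1) (by omega) (by omega)) r) s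
    rw [pairing, Matrix.sum_apply] at h2
    rw [Matrix.sum_apply]
    simp only [Matrix.mul_assoc] at h2
    exact h2
  have h3 := congrArg (fun M => M * (blockCol p (phi a b (lam i)) * P i)) h1
  simp only [Matrix.zero_mul, Matrix.sum_mul] at h3
  rw [← h3, Finset.sum_eq_single i]
  · rw [Matrix.mul_assoc, ← Matrix.mul_assoc (W i * _),
      weight_mul_conjTranspose_mul hr hpair hsum, if_pos rfl]
  · intro j _ hj
    rw [Matrix.mul_assoc, ← Matrix.mul_assoc (W j * _),
      weight_mul_conjTranspose_mul hr hpair hsum, if_neg hj, Matrix.mul_zero]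
  · simp

/-- `Wᵢ Φᵢ^*` annihilates the eigenvectors for eigenvalues other than `λᵢ`. -/
theorem IsSpectralResolution.weight_mulVec_eq_zero (h : IsSpectralResolution a b lam P G W)
    (ha : ∀ n, IsUnit (a n)) (hb : ∀ n, (b n).IsHermitian) {x : ℝ} {u : Fin p × Fin m → ℂ}
    (hu : jacobi a b *ᵥ u = (x : ℂ) • u) {i : Fin N} (hi : lam i ≠ x) :
    (W i * (blockCol p (phi a b (lam i)))ᴴ) *ᵥ u = 0 := by
  have hJ := isHermitian_jacobi a b hb
  have e1 := congrArg Matrix.conjTranspose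
    (jacobi_mul_phi_mul (b := b) ha (lam i) (W i) (h.phi_mul_weight i))
  rw [Matrix.conjTranspose_mul, hJ.eq, Matrix.conjTranspose_smul,
    show star (lam i : ℂ) = lam i from Complex.conj_ofReal _, Matrix.conjTranspose_mul,
    (h.pair i).weight_herm] at e1
  have e2 : (lam i : ℂ) • ((W i * (blockCol p (phi a b (lam i)))ᴴ) *ᵥ u) =
      (x : ℂ) • ((W i * (blockCol p (phi a b (lam i)))ᴴ) *ᵥ u) := by
    rw [← Matrix.smul_mulVec, ← e1, ← Matrix.mulVec_mulVec, hu, Matrix.mulVec_smul]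
  rw [← sub_eq_zero, ← sub_smul, smul_eq_zero] at e2
  rcases e2 with h' | h'
  · exact absurd (Complex.ofReal_injective (sub_eq_zero.1 h')) hi
  · exact h'

theorem IsSpectralResolution.eq_sum_mulVec (h : IsSpectralResolution a b lam P G W)
    (u : Fin p × Fin m → ℂ) :
    u = ∑ j, blockCol p (phi a b (lam j)) *ᵥ
      ((W j * (blockCol p (phi a b (lam j)))ᴴ) *ᵥ u) := by
  conv_lhs => rw [← Matrix.one_mulVec u, ← h.sum_eq_one, Matrix.sum_mulVec]
  exact Finset.sum_congr rfl fun j _ => by rw [Matrix.mulVec_mulVec]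

theorem IsSpectralResolution.mem_eigenvalueSet_iff (h : IsSpectralResolution a b lam P G W)
    (hp : 1 ≤ p) (ha : ∀ n, IsUnit (a n)) (hb : ∀ n, (b n).IsHermitian) (hP : ∀ j, P j ≠ 0)
    (x : ℝ) : x ∈ eigenvalueSet a b ↔ ∃ j, lam j = x := by
  constructor
  · intro hx
    obtain ⟨u, hu0, hu⟩ := MatrixJacobi.mem_eigenvalueSet_iff.1 hx
    by_contra hne
    push Not at hne
    apply hu0
    rw [h.eq_sum_mulVec u]
    refine Finset.sum_eq_zero fun j _ => ?_
    rw [h.weight_mulVec_eq_zero ha hb hu (hne j), Matrix.mulVec_zero]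
  · rintro ⟨j, rfl⟩
    obtain ⟨w, hw⟩ : ∃ w, P j *ᵥ w ≠ 0 := by
      by_contra hne
      push Not at hne
      exact hP j (Matrix.ext_of_mulVec_single fun k => by rw [hne, Matrix.zero_mulVec])
    refine MatrixJacobi.mem_eigenvalueSet_iff.2
      ⟨blockCol p (phi a b (lam j)) *ᵥ (P j *ᵥ w), fun h0 => hw ?_, ?_⟩
    · exact blockCol_phi_mulVec_eq_zero hp h0
    · refine jacobi_mulVec_phi_mulVec ha _ ?_
      rw [Matrix.mulVec_mulVec, h.phi_mul_proj, Matrix.zero_mulVec]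

theorem IsSpectralResolution.kerProj_eq (h : IsSpectralResolution a b lam P G W)
    (hp : 1 ≤ p) (ha : ∀ n, IsUnit (a n)) (hb : ∀ n, (b n).IsHermitian)
    (hinj : Function.Injective lam) (j : Fin N) :
    kerProj (phi a b (lam j) (p + 1)) = P j := by
  refine kerProj_eq_of_mul_eq_zero (h.pair j).proj_herm (h.phi_mul_proj j) fun v hv => ?_
  have hu := jacobi_mulVec_phi_mulVec (b := b) ha (lam j) hv
  have e := h.eq_sum_mulVec (blockCol p (phi a b (lam j)) *ᵥ v)
  rw [Finset.sum_eq_single j (fun i _ hi => by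
    rw [h.weight_mulVec_eq_zero ha hb hu (fun h' => hi (hinj h')), Matrix.mulVec_zero])
    (by simp)] at e
  have e2 : v = (W j * (blockCol p (phi a b (lam j)))ᴴ) *ᵥ (blockCol p (phi a b (lam j)) *ᵥ v) := by
    rw [← sub_eq_zero]
    refine blockCol_phi_mulVec_eq_zero (a := a) (b := b) (z := lam j) hp ?_
    rw [Matrix.mulVec_sub, ← e, sub_self]
  rw [e2]
  conv_lhs => rw [Matrix.mulVec_mulVec, ← Matrix.mul_assoc, (h.pair j).proj_mul_weight]

theorem IsSpectralResolution.gram_eq (h : IsSpectralResolution a b lam P G W)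
    (hr : ∑ j, (P j).rank = m * p) (j : Fin N) :
    G j = P j * ((blockCol p (phi a b (lam j)))ᴴ * blockCol p (phi a b (lam j))) * P j := by
  have e := weight_mul_conjTranspose_mul hr h.pair h.sum_eq_one j j
  rw [if_pos rfl] at e
  conv_lhs => rw [← (h.pair j).gram_mul_proj, ← e]
  simp only [← Matrix.mul_assoc]
  rw [(h.pair j).gram_mul_weight]

end eigenvectors

/-! ### The spectral mapping -/

section Psi

variable {m p : ℕ} {a : Fin (p - 1) → Matrix (Fin m) (Fin m) ℂ}
  {b : Fin p → Matrix (Fin m) (Fin m) ℂ}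

theorem isPosDefOp_of_posSemidef_liftRan {P : Matrix (Fin m) (Fin m) ℂ} (hP : P * P = P)
    {g : ran P →ₗ[ℂ] ran P} (hG : (liftRan P g).PosSemidef)
    (h0 : ∀ v, liftRan P g *ᵥ v = 0 → P *ᵥ v = 0) : IsPosDefOp g := by
  refine ⟨fun v w => ?_, fun v hv => ?_⟩
  · rw [Submodule.coe_inner, Submodule.coe_inner, ← toEuclideanLin_liftRan_coe hP,
      ← toEuclideanLin_liftRan_coe hP]
    exact Matrix.isSymmetric_toEuclideanLin_iff.2 hG.isHermitian _ _
  · set x : Fin m → ℂ := WithLp.ofLp (v : EuclideanSpace ℂ (Fin m)) with hx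
    have h1 : inner ℂ v (g v) = star x ⬝ᵥ (liftRan P g *ᵥ x) := by
      rw [Submodule.coe_inner, ← toEuclideanLin_liftRan_coe hP,
        EuclideanSpace.inner_eq_star_dotProduct, dotProduct_comm, Matrix.toLpLin_apply]
    rw [← inner_conj_symm (𝕜 := ℂ) (g v) v, Complex.conj_re, h1]
    have h2 := hG.dotProduct_mulVec_nonneg x
    refine (Complex.pos_iff.1 (lt_of_le_of_ne h2 fun h3 => hv ?_)).1
    have h4 := h0 x ((hG.dotProduct_mulVec_zero_iff x).1 h3.symm)
    apply Subtype.ext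
    have h5 := toEuclideanLin_apply_of_mem_ran hP v.2
    rw [← h5, Matrix.toLpLin_apply, h4]
    rfl

theorem liftRan_restrictRan_mul {P : Matrix (Fin m) (Fin m) ℂ} (hP : P * P = P)
    (S : Matrix (Fin m) (Fin m) ℂ) : liftRan P (restrictRan P (S * P)) = P * S * P := by
  rw [liftRan_restrictRan, ← Matrix.mul_assoc, Matrix.mul_assoc _ P P, hP]

/-- A strictly increasing enumeration of the eigenvalues, with the right projectors and Gram
operators, is the value of `Ψ`. -/
theorem Psi_eq_of_forall {D : SpectralTuple m} (hmono : StrictMono D.lam)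
    (hspec : ∀ x, x ∈ eigenvalueSet a b ↔ ∃ j, D.lam j = x)
    (hPP : ∀ j, D.P j * D.P j = D.P j)
    (hP : ∀ j, kerProj (phi a b (D.lam j) (p + 1)) = D.P j)
    (hG : ∀ j, liftRan (D.P j) (D.g j) = D.P j *
      (∑ n ∈ Finset.Icc 1 p, (phi a b (D.lam j) n)ᴴ * phi a b (D.lam j) n) * D.P j) :
    Psi (a, b) = D := by
  obtain ⟨N, lam, P, g⟩ := D
  simp only at hmono hspec hPP hP hG
  have hs : (eigenvalueSet_finite a b).toFinset = Finset.univ.image lam := by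
    ext x
    simp [hspec]
  have hN : (eigenvalueSet_finite a b).toFinset.card = N := by
    rw [hs, Finset.card_image_of_injective _ hmono.injective, Finset.card_univ, Fintype.card_fin]
  subst hN
  obtain rfl : lam = fun j => (eigenvalueSet_finite a b).toFinset.orderEmbOfFin rfl j :=
    Finset.orderEmbOfFin_unique rfl (fun j => by
      rw [Set.Finite.mem_toFinset, hspec]; exact ⟨j, rfl⟩) hmono
  obtain rfl : P = fun j => kerProj (phi a b
      ((eigenvalueSet_finite a b).toFinset.orderEmbOfFin rfl j) (p + 1)) :=
    funext fun j => (hP j).symm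
  obtain rfl := funext fun j => liftRan_injective (hPP j) (a₁ := g j)
    (a₂ := restrictRan _ ((∑ n ∈ Finset.Icc 1 p, (phi a b _ n)ᴴ * phi a b _ n) * _)) 
    ((hG j).trans (liftRan_restrictRan_mul (hPP j) _).symm)
  rfl

theorem Psi_lam_strictMono (ab : (Fin (p - 1) → Matrix (Fin m) (Fin m) ℂ) ×
    (Fin p → Matrix (Fin m) (Fin m) ℂ)) : StrictMono (Psi ab).lam :=
  (Finset.orderEmbOfFin _ rfl).strictMono

theorem mem_eigenvalueSet_iff_Psi_lam (x : ℝ) :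
    x ∈ eigenvalueSet a b ↔ ∃ j, (Psi (a, b)).lam j = x := by
  rw [← (eigenvalueSet_finite a b).mem_toFinset, ← Finset.mem_coe,
    ← Finset.range_orderEmbOfFin _ rfl]
  rfl

theorem liftRan_Psi (j : Fin (Psi (a, b)).N) :
    liftRan ((Psi (a, b)).P j) ((Psi (a, b)).g j) = (Psi (a, b)).P j *
      ((blockCol p (phi a b ((Psi (a, b)).lam j)))ᴴ * blockCol p (phi a b ((Psi (a, b)).lam j))) *
        (Psi (a, b)).P j := by
  have hPP : (Psi (a, b)).P j * (Psi (a, b)).P j = (Psi (a, b)).P j :=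
    (isStarProjection_kerProj _).isIdempotentElem
  rw [conjTranspose_blockCol_mul_blockCol]
  exact liftRan_restrictRan_mul hPP _

theorem isPosDefOp_Psi_g (hp : 1 ≤ p) (j : Fin (Psi (a, b)).N) : IsPosDefOp ((Psi (a, b)).g j) := by
  have hproj : IsStarProjection ((Psi (a, b)).P j) := isStarProjection_kerProj _
  set Φ := blockCol p (phi a b ((Psi (a, b)).lam j)) with hΦ
  have hG : liftRan ((Psi (a, b)).P j) ((Psi (a, b)).g j) =
      (Φ * (Psi (a, b)).P j)ᴴ * (Φ * (Psi (a, b)).P j) := by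
    rw [liftRan_Psi, Matrix.conjTranspose_mul,
      show ((Psi (a, b)).P j)ᴴ = (Psi (a, b)).P j from hproj.isSelfAdjoint]
    simp only [Matrix.mul_assoc, hΦ]
  refine isPosDefOp_of_posSemidef_liftRan hproj.isIdempotentElem ?_ fun v hv => ?_
  · rw [hG]; exact Matrix.posSemidef_conjTranspose_mul_self _
  · rw [hG, Matrix.conjTranspose_mul_self_mulVec_eq_zero, ← Matrix.mulVec_mulVec] at hv
    exact blockCol_phi_mulVec_eq_zero hp hv

theorem isSpectralResolution_Psi (hp : 1 ≤ p) (ha : ∀ n, IsUnit (a n))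
    (hb : ∀ n, (b n).IsHermitian) :
    IsSpectralResolution a b (Psi (a, b)).lam (Psi (a, b)).P
      (fun j => liftRan ((Psi (a, b)).P j) ((Psi (a, b)).g j))
      (fun j => weight ((Psi (a, b)).P j) ((Psi (a, b)).g j)) :=
  isSpectralResolution_of_gram ha hb (Psi_lam_strictMono _).injective
    (fun x hx => (mem_eigenvalueSet_iff_Psi_lam x).1 hx) (fun _ => rfl)
    (fun j => isInversePairOn_liftRan_weight (isStarProjection_kerProj _) (isPosDefOp_Psi_g hp j))
    liftRan_Psi

theorem Psi_P_ne_zero (ha : ∀ n, IsUnit (a n)) (j : Fin (Psi (a, b)).N) :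
    (Psi (a, b)).P j ≠ 0 := by
  intro h
  obtain ⟨u, hu0, hu⟩ := mem_eigenvalueSet_iff.1 ((mem_eigenvalueSet_iff_Psi_lam _).2 ⟨j, rfl⟩)
  obtain ⟨v, hv, rfl⟩ := exists_eq_phi_mulVec ha hu
  have h1 : (Psi (a, b)).P j *ᵥ v = v := kerProj_mulVec hv
  rw [h, Matrix.zero_mulVec] at h1
  rw [← h1, Matrix.mulVec_zero] at hu0
  exact hu0 rfl

theorem le_and_le_of_sum_rank (hm : 1 ≤ m) {N : ℕ} {P : Fin N → Matrix (Fin m) (Fin m) ℂ}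
    (hr : ∑ j, (P j).rank = m * p) (h0 : ∀ j, P j ≠ 0) : p ≤ N ∧ N ≤ p * m := by
  constructor
  · have h : ∑ j, (P j).rank ≤ ∑ _j : Fin N, m := Finset.sum_le_sum fun j _ => (P j).rank_le_width
    rw [hr, Finset.sum_const, Finset.card_univ, Fintype.card_fin, smul_eq_mul, mul_comm N] at h
    exact Nat.le_of_mul_le_mul_left h hm
  · have h : ∑ _j : Fin N, 1 ≤ ∑ j, (P j).rank := Finset.sum_le_sum fun j _ =>
      Nat.one_le_iff_ne_zero.2 fun h => h0 j (by
        rw [Matrix.rank, Submodule.finrank_eq_zero, LinearMap.range_eq_bot] at h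
        exact Matrix.ext_of_mulVec_single fun k => by
          rw [← Matrix.mulVecLin_apply, h, Matrix.zero_mulVec]; rfl)
    rw [hr, mul_comm] at h
    simpa using h

theorem Psi_mem_spectralDataSet (hm : 1 ≤ m) (hp : 1 ≤ p) (ha : ∀ n, IsUnit (a n))
    (hb : ∀ n, (b n).IsHermitian) : Psi (a, b) ∈ spectralDataSet m p := by
  have hres := isSpectralResolution_Psi hp ha hb
  have hr := hres.sum_rank liftRan_Psi
  refine ⟨le_and_le_of_sum_rank hm hr (Psi_P_ne_zero ha), Psi_lam_strictMono _,
    ⟨(Psi_lam_strictMono _).injective, fun j => isStarProjection_kerProj _, hr, ?_⟩,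
    Psi_P_ne_zero ha, isPosDefOp_Psi_g hp, ?_⟩
  · exact (det_hankel_proj_ne_zero_iff _ hres.pair).2
      (det_hankel_ne_zero_of_orthonormal a b _ _ hres.sum_eq_one)
  · simp only [sandwich_eq_toEuclideanLin_weight]
    rw [← map_sum, hres.sum_weight hp, Matrix.toLpLin_one]

/-- Surjectivity: the measure with weights `Pⱼ gⱼ⁻¹ Pⱼ` is orthonormalized. -/
theorem exists_Psi_eq {C : Matrix (Fin m) (Fin m) ℂ → Prop} (hC : IsFactorClass C) (hp : 1 ≤ p)
    {D : SpectralTuple m} (hD : D ∈ spectralDataSet m p) :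
    ∃ (a : Fin (p - 1) → Matrix (Fin m) (Fin m) ℂ) (b : Fin p → Matrix (Fin m) (Fin m) ℂ),
      (∀ n, C (a n)) ∧ (∀ n, (b n).IsHermitian) ∧ Psi (a, b) = D := by
  obtain ⟨-, hmono, ⟨hinj, hproj, hr, hdet⟩, hP0, hg, hsum⟩ := hD
  have hpair := fun j => isInversePairOn_liftRan_weight (hproj j) (hg j)
  have hW1 : ∑ j, weight (D.P j) (D.g j) = 1 := by
    apply Matrix.toEuclideanLin.injective
    simp only [sandwich_eq_toEuclideanLin_weight] at hsum
    rw [map_sum, hsum, Matrix.toLpLin_one]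
  obtain ⟨a, b, haC, hb, ho, hd⟩ := exists_isOrthonormalUpTo hC hp
    (fun j => (hpair j).weight_posSemidef) hW1
    ((det_hankel_proj_ne_zero_iff D.lam hpair).1 hdet) p hp le_rfl
  have ha := fun n => hC.isUnit _ (haC n)
  have hres := isSpectralResolution_of_orthonormal hp ha hr hpair ho hd
  refine ⟨a, b, haC, hb, Psi_eq_of_forall hmono (hres.mem_eigenvalueSet_iff hp ha hb hP0)
    (fun j => (hpair j).proj_mul_proj) (hres.kerProj_eq hp ha hb hinj) fun j => ?_⟩
  rw [hres.gram_eq hr j, conjTranspose_blockCol_mul_blockCol]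

theorem bijOn_Psi {C : Matrix (Fin m) (Fin m) ℂ → Prop} (hC : IsFactorClass C) (hm : 1 ≤ m)
    (hp : 1 ≤ p) :
    Set.BijOn (Psi (m := m) (p := p)) {ab | (∀ n, C (ab.1 n)) ∧ ∀ n, (ab.2 n).IsHermitian}
      (spectralDataSet m p) := by
  refine ⟨?_, ?_, ?_⟩
  · rintro ⟨a, b⟩ ⟨ha, hb⟩
    exact Psi_mem_spectralDataSet hm hp (fun n => hC.isUnit _ (ha n)) hb
  · rintro ⟨a, b⟩ ⟨ha, hb⟩ ⟨a', b'⟩ ⟨ha', hb'⟩ h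
    have h1 := isSpectralResolution_Psi hp (fun n => hC.isUnit _ (ha n)) hb
    have h2 := isSpectralResolution_Psi hp (fun n => hC.isUnit _ (ha' n)) hb'
    rw [← h] at h2
    obtain ⟨rfl, rfl⟩ := eq_of_isOrthonormalUpTo hC ha ha' (fun j => (h1.pair j).weight_herm)
      h1.isOrthonormalUpTo h1.phi_mul_weight h2.isOrthonormalUpTo h2.phi_mul_weight
    rfl
  · intro D hD
    obtain ⟨a, b, ha, hb, h⟩ := exists_Psi_eq hC hp hD
    exact ⟨(a, b), ⟨ha, hb⟩, h⟩

end Psi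

end MatrixJacobi

end

theorem theorem1p4 (m p : ℕ) (hm : 1 ≤ m) (hp : 1 ≤ p) :
    Set.BijOn MatrixJacobi.Psi (MatrixJacobi.posDefPairs m p)
        (MatrixJacobi.spectralDataSet m p) ∧
      Set.BijOn MatrixJacobi.Psi (MatrixJacobi.lowerPosPairs m p)
        (MatrixJacobi.spectralDataSet m p) :=
  ⟨MatrixJacobi.bijOn_Psi (MatrixJacobi.isFactorClass_posDef m) hm hp,
    MatrixJacobi.bijOn_Psi (MatrixJacobi.isFactorClass_isLowerPos m) hm hp⟩
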